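/- **Theorem (Structure theorem for special quasi-elliptic functions).** Fix $\tau\in\mathbb{C}$ with $\operatorname{Im}\tau>0$ and let $\Lambda=\mathbb{Z}+\mathbb{Z}\tau$. For a meromorphic function $f$ on $\mathbb{C}$ put $\Delta f(x)=f(x+\tau)-f(x)$. For $k\ge 0$ let $K_k$ be the space of meromorphic functions $f$ on $\mathbb{C}$ with $f(x+1)=f(x)$ and $\Delta^k f=0$. Let $SK$ be the ring of special quasi-elliptic functions, i.e. of those $f\in\bigcup_{k\ge0}K_k$ all of whose poles lie in $\Lambda$, and let $SK_1=SK\cap K_1$ be its subring of special elliptic functions. Let $\wp$ and $\zeta$ be the Weierstrass functions of $\Lambda$, let $e_2=\sum_{m\in\mathbb{Z}}\bigl(\sum_{n\in\mathbb{Z},\,(m,n)\ne(0,0)}(m\tau+n)^{-2}\bigr)$ be the Eisenstein series of weight two (the outer sum is the limit of its symmetric partial sums $|m|\le N$), and let $\mathscr{Z}(x)=\zeta(x)-e_2x$ be Eisenstein's zeta function. Let $\mathcal{P}^{\mathbb{N}}$ be the space of maps $m\mapsto\sum_{\ell\ge1}p_\ell(m)\,\mathbf{e}_\ell$ from $\mathbb{Z}$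 to the complex vector space with basis $(\mathbf{e}_\ell)_{\ell\ge1}$, where $p_\ell\in\mathbb{C}[m]$ and only finitely many $p_\ell$ are nonzero. For $f\in SK$ let $\sigma(f)$ be the map $m\mapsto\sum_{\ell\ge1}f_\ell(m)\,\mathbf{e}_\ell$ on $\mathbb{Z}$, where $f_\ell(m)$ is the coefficient of $(x-m\tau)^{-\ell}$ in the Laurent expansion of $f$ at $m\tau$. The linear map $\sigma$ vanishes on constants, so it is defined on $SK/\mathbb{C}$. Then $SK_1=\mathbb{C}[\wp,\wp']$, the ring generated by $\wp$ and $\wp'$ over $\mathbb{C}$, and: (a) $\mathscr{Z}\in SK$, and $SK=SK_1[\mathscr{Z}]$ is a polynomial ring in the one variable $\mathscr{Z}$ over $SK_1$; moreover $SK$ is a free $SK_1$-module with basis $\{\mathscr{Z}^k : k\ge 0\}$. (b) The image of $\sigma$ is contained in $\mathcal{P}^{\mathbb{N}}$: for each $f\in SK$ every $f_\ell(m)$ is a polynomial in $m$, and $f_\ell=0$ for all but finitely many $\ell$. (c) The induced map $\sigma: SK/\mathbb{C}\to\mathcal{P}^{\mathbb{N}}$ is an isomorphism of complex vector spaces. 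-/

import Mathlib

open Filter Topology
open scoped UpperHalfPlane

noncomputable section

namespace QuasiElliptic

/-! ### The ring of meromorphic functions on the complex plane -/

/-- Complex functions modulo equality off a closed discrete subset of `ℂ`. -/
abbrev Fun : Type := Germ (codiscrete ℂ) ℂ

instance : Algebra ℂ Fun :=
  Algebra.ofModule
    (fun r x y => by
      induction x using Germ.inductionOn with | _ f
      induction y using Germ.inductionOn with | _ g
      rw [← Germ.coe_smul, ← Germ.coe_mul, ← Germ.coe_mul, ← Germ.coe_smul, smul_mul_assoc])
    (fun r x y => by
      induction x using Germ.inductionOn with | _ f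
      induction y using Germ.inductionOn with | _ g
      rw [← Germ.coe_smul, ← Germ.coe_mul, ← Germ.coe_mul, ← Germ.coe_smul, mul_smul_comm])

lemma algebraMap_eq (r : ℂ) : algebraMap ℂ Fun r = ((fun _ : ℂ => r : ℂ → ℂ) : Fun) := by
  rw [Algebra.algebraMap_eq_smul_one, ← Germ.coe_one, ← Germ.coe_smul]
  congr 1
  funext z
  simp

/-- Equality off a closed discrete set implies equality near each point, the point excluded. -/
lemma eventuallyEq_nhdsNE {f g : ℂ → ℂ} (h : f =ᶠ[codiscrete ℂ] g) (x : ℂ) :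
    f =ᶠ[𝓝[≠] x] g := by
  have := mem_codiscrete.1 h x
  rw [disjoint_principal_right, compl_compl] at this
  exact this

/-- The order of vanishing at `x`; negative exactly at the poles. -/
def orderAt (φ : Fun) (x : ℂ) : WithTop ℤ :=
  φ.liftOn (fun f => meromorphicOrderAt f x)
    (fun _ _ h => meromorphicOrderAt_congr (eventuallyEq_nhdsNE h x))

@[simp] lemma orderAt_coe (f : ℂ → ℂ) (x : ℂ) :
    orderAt (f : Fun) x = meromorphicOrderAt f x := rfl

/-- The ring of meromorphic functions on `ℂ`, two of them being identified
when they agree off a closed discrete set. -/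
def Mer : Subalgebra ℂ Fun where
  carrier := {φ | ∃ f : ℂ → ℂ, Meromorphic f ∧ (f : Fun) = φ}
  mul_mem' := by
    rintro _ _ ⟨f, hf, rfl⟩ ⟨g, hg, rfl⟩
    exact ⟨f * g, hf.mul hg, Germ.coe_mul f g⟩
  add_mem' := by
    rintro _ _ ⟨f, hf, rfl⟩ ⟨g, hg, rfl⟩
    exact ⟨f + g, hf.add hg, Germ.coe_add f g⟩
  algebraMap_mem' r := ⟨fun _ => r, Meromorphic.const r, (algebraMap_eq r).symm⟩

lemma tendsto_add_codiscrete (a : ℂ) :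
    Tendsto (fun x : ℂ => x + a) (codiscrete ℂ) (codiscrete ℂ) := by
  intro s hs
  rw [mem_codiscrete] at hs
  rw [mem_map, mem_codiscrete]
  intro x
  have h := hs (x + a)
  rw [disjoint_principal_right, compl_compl] at h ⊢
  have ht : Tendsto (fun x : ℂ => x + a) (𝓝[≠] x) (𝓝[≠] (x + a)) := by
    refine tendsto_nhdsWithin_of_tendsto_nhds_of_eventually_within _ ?_ ?_
    · exact ((continuous_id.add continuous_const).tendsto x).mono_left nhdsWithin_le_nhds
    · filter_upwards [self_mem_nhdsWithin] with y hy
      simpa using hy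
  exact ht h

/-- The translation `f ↦ f(· + a)`. -/
def translate (a : ℂ) : Fun →ₐ[ℂ] Fun where
  toFun φ := φ.compTendsto (fun x => x + a) (tendsto_add_codiscrete a)
  map_one' := rfl
  map_mul' x y := by
    induction x using Germ.inductionOn with | _ f
    induction y using Germ.inductionOn with | _ g
    rfl
  map_zero' := rfl
  map_add' x y := by
    induction x using Germ.inductionOn with | _ f
    induction y using Germ.inductionOn with | _ g
    rfl
  commutes' r := by
    rw [algebraMap_eq]
    rfl

lemma translate_coe (a : ℂ) (f : ℂ → ℂ) :
    translate a (f : Fun) = ((fun x => f (x + a) : ℂ → ℂ) : Fun) := rfl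

/-- The forward difference operator `Δ f (x) = f (x + τ) - f (x)`. -/
def diff (τ : ℍ) : Fun →ₗ[ℂ] Fun := (translate (τ : ℂ)).toLinearMap - LinearMap.id

lemma diff_apply (τ : ℍ) (φ : Fun) : diff τ φ = translate (τ : ℂ) φ - φ := rfl

lemma diff_mul (τ : ℍ) (φ ψ : Fun) :
    diff τ (φ * ψ) = diff τ φ * ψ + φ * diff τ ψ + diff τ φ * diff τ ψ := by
  simp only [diff_apply, map_mul]
  ring

lemma diff_pow_mul (τ : ℍ) (r s : ℕ) (φ ψ : Fun) (hφ : (diff τ ^ r) φ = 0)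
    (hψ : (diff τ ^ s) ψ = 0) : (diff τ ^ (r + s)) (φ * ψ) = 0 := by
  induction hn : r + s generalizing r s φ ψ with
  | zero =>
    obtain rfl : r = 0 := by omega
    have : φ = 0 := by simpa using hφ
    simp [this]
  | succ n ih =>
    rcases r with _ | r
    · have : φ = 0 := by simpa using hφ
      simp [this]
    rcases s with _ | s
    · have : ψ = 0 := by simpa using hψ
      simp [this]
    have h1 : (diff τ ^ r) (diff τ φ) = 0 := by
      rw [pow_succ] at hφ; exact hφ
    have h2 : (diff τ ^ s) (diff τ ψ) = 0 := by
      rw [pow_succ] at hψ; exact hψ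
    have h3 : (diff τ ^ (s + 1)) (diff τ ψ) = 0 := by
      rw [pow_succ', Module.End.mul_apply, h2, map_zero]
    rw [pow_succ, Module.End.mul_apply, diff_mul, map_add, map_add,
      ih r (s + 1) _ _ h1 hψ (by omega), ih (r + 1) s _ _ hφ h2 (by omega),
      ih r (s + 1) _ _ h1 h3 (by omega)]
    simp

/-! ### Quasi-elliptic functions -/

/-- The pair of periods `(1, τ)`, with lattice `Λ = ℤ + ℤ τ`. -/
def periods (τ : ℍ) : PeriodPair where
  ω₁ := 1
  ω₂ := τ
  indep := by
    rw [LinearIndependent.pair_iff]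
    intro s t h
    have him : t * (τ : ℂ).im = 0 := by simpa using congrArg Complex.im h
    have ht : t = 0 := (mul_eq_zero.1 him).resolve_right τ.im_ne_zero
    subst ht
    exact ⟨by simpa using congrArg Complex.re h, rfl⟩

/-- The space `K_k` of meromorphic functions of period `1` that are annihilated by `Δ ^ k`. -/
def K (τ : ℍ) (k : ℕ) : Submodule ℂ Fun :=
  Subalgebra.toSubmodule Mer ⊓ LinearMap.ker ((translate 1).toLinearMap - LinearMap.id) ⊓
    LinearMap.ker (diff τ ^ k)

lemma mem_K {τ : ℍ} {k : ℕ} {φ : Fun} :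
    φ ∈ K τ k ↔ φ ∈ Mer ∧ translate 1 φ = φ ∧ (diff τ ^ k) φ = 0 := by
  simp [K, and_assoc, sub_eq_zero]

lemma K_mono (τ : ℍ) {k l : ℕ} (h : k ≤ l) : K τ k ≤ K τ l := by
  intro φ hφ
  rw [mem_K] at hφ ⊢
  refine ⟨hφ.1, hφ.2.1, ?_⟩
  obtain ⟨j, rfl⟩ := Nat.exists_eq_add_of_le h
  rw [add_comm, pow_add, Module.End.mul_apply, hφ.2.2, map_zero]

/-- All poles lie in the lattice `Λ`. -/
def PolesInLattice (τ : ℍ) (φ : Fun) : Prop :=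
  ∀ x : ℂ, x ∉ (periods τ).lattice → 0 ≤ orderAt φ x

lemma PolesInLattice.add {τ : ℍ} {φ ψ : Fun} (hφ : φ ∈ Mer) (hψ : ψ ∈ Mer)
    (h : PolesInLattice τ φ) (h' : PolesInLattice τ ψ) : PolesInLattice τ (φ + ψ) := by
  obtain ⟨f, hf, rfl⟩ := hφ
  obtain ⟨g, hg, rfl⟩ := hψ
  intro x hx
  rw [← Germ.coe_add, orderAt_coe]
  exact (le_min (h x hx) (h' x hx)).trans (meromorphicOrderAt_add (hf x) (hg x))

lemma PolesInLattice.mul {τ : ℍ} {φ ψ : Fun} (hφ : φ ∈ Mer) (hψ : ψ ∈ Mer)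
    (h : PolesInLattice τ φ) (h' : PolesInLattice τ ψ) : PolesInLattice τ (φ * ψ) := by
  obtain ⟨f, hf, rfl⟩ := hφ
  obtain ⟨g, hg, rfl⟩ := hψ
  intro x hx
  rw [← Germ.coe_mul, orderAt_coe, meromorphicOrderAt_mul (hf x) (hg x)]
  exact add_nonneg (h x hx) (h' x hx)

lemma orderAt_algebraMap_nonneg (r x : ℂ) : 0 ≤ orderAt (algebraMap ℂ Fun r) x := by
  rw [algebraMap_eq, orderAt_coe]
  exact (analyticAt_const (v := r) (x := x)).meromorphicOrderAt_nonneg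

lemma algebraMap_mem_K (τ : ℍ) (r : ℂ) : algebraMap ℂ Fun r ∈ K τ 1 := by
  rw [mem_K]
  refine ⟨Mer.algebraMap_mem r, AlgHom.commutes _ r, ?_⟩
  rw [pow_one, diff_apply, AlgHom.commutes, sub_self]

/-- The ring `SK` of special quasi-elliptic functions: the functions that lie in some `K_k` and
have all their poles in the lattice. -/
def SK (τ : ℍ) : Subalgebra ℂ Fun where
  carrier := {φ | (∃ k, φ ∈ K τ k) ∧ PolesInLattice τ φ}
  mul_mem' := by
    rintro φ ψ ⟨⟨r, hr⟩, hφ⟩ ⟨⟨s, hs⟩, hψ⟩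
    rw [mem_K] at hr hs
    refine ⟨⟨r + s, mem_K.2 ⟨mul_mem hr.1 hs.1, ?_, ?_⟩⟩, hφ.mul hr.1 hs.1 hψ⟩
    · rw [map_mul, hr.2.1, hs.2.1]
    · exact diff_pow_mul τ r s φ ψ hr.2.2 hs.2.2
  add_mem' := by
    rintro φ ψ ⟨⟨r, hr⟩, hφ⟩ ⟨⟨s, hs⟩, hψ⟩
    exact ⟨⟨max r s, add_mem (K_mono τ (le_max_left r s) hr) (K_mono τ (le_max_right r s) hs)⟩,
      hφ.add (mem_K.1 hr).1 (mem_K.1 hs).1 hψ⟩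
  algebraMap_mem' r :=
    ⟨⟨1, algebraMap_mem_K τ r⟩, fun x _ => orderAt_algebraMap_nonneg r x⟩

lemma SK_le_Mer (τ : ℍ) : SK τ ≤ Mer := fun _ h => (mem_K.1 h.1.choose_spec).1

/-- The ring `SK_1 = SK ∩ K_1` of special elliptic functions. -/
def SK₁ (τ : ℍ) : Subalgebra ℂ Fun where
  carrier := {φ | φ ∈ SK τ ∧ φ ∈ K τ 1}
  mul_mem' := by
    rintro φ ψ ⟨h, h1⟩ ⟨h', h1'⟩
    refine ⟨mul_mem h h', ?_⟩
    rw [mem_K, pow_one] at h1 h1' ⊢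
    refine ⟨mul_mem h1.1 h1'.1, ?_, ?_⟩
    · rw [map_mul, h1.2.1, h1'.2.1]
    · rw [diff_mul, h1.2.2, h1'.2.2]
      simp
  add_mem' := by
    rintro φ ψ ⟨h, h1⟩ ⟨h', h1'⟩
    exact ⟨add_mem h h', add_mem h1 h1'⟩
  algebraMap_mem' r := ⟨(SK τ).algebraMap_mem r, algebraMap_mem_K τ r⟩

lemma SK₁_le_SK (τ : ℍ) : SK₁ τ ≤ SK τ := fun _ h => h.1

/-- `SK` as an algebra over its subring `SK_1`. -/
instance (τ : ℍ) : Algebra (SK₁ τ) (SK τ) :=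
  (Subalgebra.inclusion (SK₁_le_SK τ)).toRingHom.toAlgebra

/-! ### The functions of Weierstrass and Eisenstein -/

/-- The Weierstrass `ζ` function of `Λ = ℤ + ℤ τ`, that is
`ζ(z) = 1/z + ∑ (1/(z-l) + 1/l + z/l²)` over nonzero `l ∈ Λ`.
(Since `1/0 = 0`, the term `l = 0` of the sum below is `1/z`.) -/
def weierstrassZeta (τ : ℍ) (z : ℂ) : ℂ :=
  ∑' l : (periods τ).lattice, (1 / (z - l) + 1 / (l : ℂ) + z / (l : ℂ) ^ 2)

/-- Eisenstein's zeta function `ζ(z) - e₂ z`, where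
`e₂ = ∑ₘ ∑ₙ (m τ + n)⁻²` (omitting `m = n = 0`) is the Eisenstein series of weight two. -/
def eisensteinZeta (τ : ℍ) (z : ℂ) : ℂ :=
  weierstrassZeta τ z - EisensteinSeries.G2 τ * z

/-- Eisenstein's zeta function as an element of the ring of functions. -/
def 𝒵 (τ : ℍ) : Fun := (eisensteinZeta τ : ℂ → ℂ)

/-- The Weierstrass function `℘` as an element of the ring of functions. -/
def weierP (τ : ℍ) : Fun := ((periods τ).weierstrassP : ℂ → ℂ)

/-- The derivative `℘'` as an element of the ring of functions. -/
def weierP' (τ : ℍ) : Fun := ((periods τ).derivWeierstrassP : ℂ → ℂ)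

/-! ### Principal parts -/

/-- The function `∑ c_l (z - x)^(-l)`, for finitely many nonzero `c_l`, `l ≥ 1`. -/
def polar (x : ℂ) (c : ℕ+ →₀ ℂ) (z : ℂ) : ℂ :=
  c.sum fun l a => a / (z - x) ^ (l : ℕ)

lemma polar_add (x : ℂ) (c d : ℕ+ →₀ ℂ) : polar x (c + d) = polar x c + polar x d := by
  funext z
  exact Finsupp.sum_add_index' (by simp) (by intros; rw [add_div])

lemma polar_smul (x a : ℂ) (c : ℕ+ →₀ ℂ) : polar x (a • c) = a • polar x c := by
  funext z
  simp only [polar, Pi.smul_apply, smul_eq_mul]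
  rw [Finsupp.sum_smul_index (by simp), Finsupp.mul_sum]
  simp only [mul_div_assoc]

lemma polar_zero (x : ℂ) : polar x 0 = 0 := by
  funext z
  simp [polar]

lemma polar_single (x : ℂ) (l : ℕ+) (a z : ℂ) :
    polar x (Finsupp.single l a) z = a / (z - x) ^ (l : ℕ) := by
  simp [polar]

lemma meromorphicAt_sub_const (x y : ℂ) : MeromorphicAt (fun z : ℂ => z - x) y :=
  (MeromorphicAt.id y).sub (MeromorphicAt.const x y)

lemma meromorphic_polar (x : ℂ) (c : ℕ+ →₀ ℂ) : Meromorphic (polar x c) := by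
  intro y
  have : polar x c = ∑ l ∈ c.support, fun z => c l / (z - x) ^ (l : ℕ) := by
    funext z
    simp [polar, Finsupp.sum]
  rw [this]
  exact MeromorphicAt.sum fun l _ =>
    (MeromorphicAt.const (c l) y).div ((meromorphicAt_sub_const x y).pow l)

/-- `c` lists the coefficients of the principal part of `φ` at `x`: the function
`φ - ∑ c_l (z - x)^(-l)` is regular at `x`. -/
def HasPrincipalPart (φ : Fun) (x : ℂ) (c : ℕ+ →₀ ℂ) : Prop :=
  0 ≤ orderAt (φ - (polar x c : ℂ → ℂ)) x

lemma exists_polar_aux (n : ℕ) (x : ℂ) (f : ℂ → ℂ) (hf : MeromorphicAt f x)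
    (h : ((-n : ℤ) : WithTop ℤ) ≤ meromorphicOrderAt f x) :
    ∃ c : ℕ+ →₀ ℂ, 0 ≤ meromorphicOrderAt (f - polar x c) x := by
  induction n generalizing f with
  | zero => exact ⟨0, by simpa [polar_zero] using h⟩
  | succ n ih =>
    have hm : MeromorphicAt (fun z : ℂ => (z - x) ^ (n + 1)) x := (meromorphicAt_sub_const x x).pow _
    have hpo : meromorphicOrderAt (fun z : ℂ => (z - x) ^ (n + 1)) x = ((n + 1 : ℕ) : ℤ) :=
      fun_meromorphicOrderAt_pow_id_sub_const
    have hg : MeromorphicAt ((fun z : ℂ => (z - x) ^ (n + 1)) * f) x := hm.mul hf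
    have hgo : 0 ≤ meromorphicOrderAt ((fun z : ℂ => (z - x) ^ (n + 1)) * f) x := by
      rw [meromorphicOrderAt_mul hm hf, hpo]
      refine le_trans ?_ (add_le_add_right h _)
      rw [← WithTop.coe_add]
      simp
    obtain ⟨a, ha⟩ := tendsto_nhds_of_meromorphicOrderAt_nonneg hg hgo
    have hk : MeromorphicAt ((fun z : ℂ => (z - x) ^ (n + 1)) * f - fun _ => a) x :=
      hg.sub (MeromorphicAt.const a x)
    have hko : 0 < meromorphicOrderAt ((fun z : ℂ => (z - x) ^ (n + 1)) * f - fun _ => a) x := by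
      rw [← tendsto_zero_iff_meromorphicOrderAt_pos hk]
      have := ha.sub (tendsto_const_nhds (x := a))
      rwa [sub_self] at this
    set s : ℕ+ →₀ ℂ := Finsupp.single n.succPNat a with hs
    have hf1 : MeromorphicAt (f - polar x s) x := hf.sub (meromorphic_polar x s x)
    have heq : (fun z : ℂ => (z - x) ^ (n + 1)) * (f - polar x s) =ᶠ[𝓝[≠] x]
        (fun z : ℂ => (z - x) ^ (n + 1)) * f - fun _ => a := by
      filter_upwards [self_mem_nhdsWithin] with z hz
      have : (z - x) ≠ 0 := sub_ne_zero.2 hz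
      simp only [Pi.mul_apply, Pi.sub_apply, hs, polar_single, Nat.succPNat_coe, Nat.succ_eq_add_one]
      field_simp
    have hord := meromorphicOrderAt_congr heq
    rw [meromorphicOrderAt_mul hm hf1, hpo] at hord
    rw [← hord] at hko
    obtain ⟨c, hc⟩ := ih (f - polar x s) hf1 (by
      cases ho : meromorphicOrderAt (f - polar x s) x with
      | top => exact le_top
      | coe o =>
        rw [ho, ← WithTop.coe_add, ← WithTop.coe_zero, WithTop.coe_lt_coe] at hko
        rw [WithTop.coe_le_coe]
        push_cast at hko
        omega)
    refine ⟨s + c, ?_⟩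
    rw [polar_add, ← sub_sub]
    exact hc

lemma polar_eq_zero_aux (x : ℂ) (c : ℕ+ →₀ ℂ) (h : 0 ≤ meromorphicOrderAt (polar x c) x) :
    c = 0 := by
  by_contra hc
  have hne : c.support.Nonempty := Finsupp.support_nonempty_iff.2 hc
  set L := c.support.max' hne with hL
  have hLm : L ∈ c.support := c.support.max'_mem hne
  obtain ⟨a, ha⟩ := tendsto_nhds_of_meromorphicOrderAt_nonneg (meromorphic_polar x c x) h
  have hid : Tendsto (fun z : ℂ => z - x) (𝓝[≠] x) (𝓝 0) := by
    have : Tendsto (fun z : ℂ => z - x) (𝓝 x) (𝓝 (x - x)) :=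
      (continuous_id.sub continuous_const).tendsto x
    rw [sub_self] at this
    exact this.mono_left nhdsWithin_le_nhds
  have hpow : ∀ k : ℕ, k ≠ 0 → Tendsto (fun z : ℂ => (z - x) ^ k) (𝓝[≠] x) (𝓝 0) := by
    intro k hk
    simpa [hk] using hid.pow k
  have h1 : Tendsto (fun z => (z - x) ^ (L : ℕ) * polar x c z) (𝓝[≠] x) (𝓝 0) := by
    simpa using (hpow L L.ne_zero).mul ha
  have h2 : Tendsto (fun z => ∑ l ∈ c.support, c l * (z - x) ^ ((L : ℕ) - (l : ℕ))) (𝓝[≠] x)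
      (𝓝 (∑ l ∈ c.support, if l = L then c l else 0)) := by
    refine tendsto_finsetSum _ fun l hl => ?_
    split_ifs with hlL
    · subst hlL
      simp
    · have hlt : l < L := lt_of_le_of_ne (c.support.le_max' l hl) hlL
      have hlt' : (l : ℕ) < (L : ℕ) := hlt
      simpa using (hpow ((L : ℕ) - (l : ℕ)) (by omega)).const_mul (c l)
  have heq : (fun z => (z - x) ^ (L : ℕ) * polar x c z) =ᶠ[𝓝[≠] x]
      fun z => ∑ l ∈ c.support, c l * (z - x) ^ ((L : ℕ) - (l : ℕ)) := by
    filter_upwards [self_mem_nhdsWithin] with z hz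
    have hz0 : z - x ≠ 0 := sub_ne_zero.2 hz
    rw [polar, Finsupp.sum, Finset.mul_sum]
    refine Finset.sum_congr rfl fun l hl => ?_
    have hle : (l : ℕ) ≤ (L : ℕ) := c.support.le_max' l hl
    rw [pow_sub₀ _ hz0 hle]
    field_simp
  have h3 := tendsto_nhds_unique (h1.congr' heq) h2
  rw [Finset.sum_ite_eq' c.support L, if_pos hLm] at h3
  exact (Finsupp.mem_support_iff.1 hLm) h3.symm

lemma HasPrincipalPart.exists {φ : Fun} (hφ : φ ∈ Mer) (x : ℂ) : ∃ c, HasPrincipalPart φ x c := by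
  obtain ⟨f, hf, rfl⟩ := hφ
  have : ∃ n : ℕ, ((-n : ℤ) : WithTop ℤ) ≤ meromorphicOrderAt f x := by
    cases ho : meromorphicOrderAt f x with
    | top => exact ⟨0, le_top⟩
    | coe o => exact ⟨o.natAbs, by rw [WithTop.coe_le_coe]; omega⟩
  obtain ⟨n, hn⟩ := this
  exact exists_polar_aux n x f (hf x) hn

lemma HasPrincipalPart.add {φ ψ : Fun} (hφ : φ ∈ Mer) (hψ : ψ ∈ Mer) {x : ℂ} {c d : ℕ+ →₀ ℂ}
    (h : HasPrincipalPart φ x c) (h' : HasPrincipalPart ψ x d) :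
    HasPrincipalPart (φ + ψ) x (c + d) := by
  obtain ⟨f, hf, rfl⟩ := hφ
  obtain ⟨g, hg, rfl⟩ := hψ
  have e : (f + g) - polar x (c + d) = (f - polar x c) + (g - polar x d) := by
    rw [polar_add, add_sub_add_comm]
  change 0 ≤ meromorphicOrderAt ((f + g) - polar x (c + d)) x
  rw [e]
  exact (le_min h h').trans (meromorphicOrderAt_add ((hf x).sub (meromorphic_polar x c x))
    ((hg x).sub (meromorphic_polar x d x)))

lemma HasPrincipalPart.smul {φ : Fun} (hφ : φ ∈ Mer) {x : ℂ} {c : ℕ+ →₀ ℂ} (a : ℂ)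
    (h : HasPrincipalPart φ x c) : HasPrincipalPart (a • φ) x (a • c) := by
  obtain ⟨f, hf, rfl⟩ := hφ
  have e : a • f - polar x (a • c) = (fun _ => a) * (f - polar x c) := by
    rw [polar_smul, ← smul_sub]
    rfl
  change 0 ≤ meromorphicOrderAt (a • f - polar x (a • c)) x
  rw [e, meromorphicOrderAt_mul (MeromorphicAt.const a x) ((hf x).sub (meromorphic_polar x c x))]
  exact add_nonneg (analyticAt_const (v := a) (x := x)).meromorphicOrderAt_nonneg h

lemma HasPrincipalPart.unique {φ : Fun} (hφ : φ ∈ Mer) {x : ℂ} {c d : ℕ+ →₀ ℂ}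
    (h : HasPrincipalPart φ x c) (h' : HasPrincipalPart φ x d) : c = d := by
  have h2 := h.add hφ (neg_mem hφ) (by simpa using h'.smul hφ (-1))
  rw [add_neg_cancel] at h2
  have h3 : HasPrincipalPart 0 x ((-1 : ℂ) • (c + -d)) := by
    simpa using h2.smul (zero_mem Mer) (-1)
  have h4 : 0 ≤ meromorphicOrderAt (0 - polar x ((-1 : ℂ) • (c + -d))) x := h3
  rw [polar_smul] at h4
  have h5 : (0 : ℂ → ℂ) - (-1 : ℂ) • polar x (c + -d) = polar x (c + -d) := by simp
  rw [h5] at h4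
  have := polar_eq_zero_aux x _ h4
  rwa [← sub_eq_add_neg, sub_eq_zero] at this

/-- The principal part at `x` of a meromorphic function: the family of the coefficients of
`(z - x)^(-l)`, `l ≥ 1`, in its Laurent expansion at `x`. -/
def principalPart (x : ℂ) : Mer →ₗ[ℂ] (ℕ+ →₀ ℂ) where
  toFun φ := (HasPrincipalPart.exists φ.2 x).choose
  map_add' φ ψ :=
    HasPrincipalPart.unique (φ + ψ).2 (HasPrincipalPart.exists (φ + ψ).2 x).choose_spec
      ((HasPrincipalPart.exists φ.2 x).choose_spec.add φ.2 ψ.2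
        (HasPrincipalPart.exists ψ.2 x).choose_spec)
  map_smul' a φ :=
    HasPrincipalPart.unique (a • φ).2 (HasPrincipalPart.exists (a • φ).2 x).choose_spec
      ((HasPrincipalPart.exists φ.2 x).choose_spec.smul φ.2 a)

lemma hasPrincipalPart_principalPart (x : ℂ) (φ : Mer) :
    HasPrincipalPart (φ : Fun) x (principalPart x φ) :=
  (HasPrincipalPart.exists φ.2 x).choose_spec

/-- The map `σ`, which sends `f ∈ SK` to the family, indexed by `m ∈ ℤ`, of its principal parts
at the points `m τ`. -/
def sigma (τ : ℍ) : SK τ →ₗ[ℂ] (ℤ → ℕ+ →₀ ℂ) :=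
  LinearMap.pi fun m =>
    principalPart ((m : ℂ) * (τ : ℂ)) ∘ₗ (Subalgebra.inclusion (SK_le_Mer τ)).toLinearMap

/-- The constant functions. -/
def constants (τ : ℍ) : Submodule ℂ (SK τ) := LinearMap.range (Algebra.linearMap ℂ (SK τ))

lemma constants_le_ker (τ : ℍ) : constants τ ≤ LinearMap.ker (sigma τ) := by
  rintro _ ⟨r, rfl⟩
  rw [LinearMap.mem_ker]
  funext m
  refine HasPrincipalPart.unique (x := (m : ℂ) * (τ : ℂ)) (Mer.algebraMap_mem r)
    (hasPrincipalPart_principalPart _ (algebraMap ℂ Mer r)) ?_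
  change 0 ≤ orderAt (algebraMap ℂ Fun r - (polar _ 0 : ℂ → ℂ)) _
  rw [polar_zero, Germ.coe_zero, sub_zero]
  exact orderAt_algebraMap_nonneg r _

/-- The map induced by `σ` on `SK / ℂ`. -/
def sigmaBar (τ : ℍ) : (SK τ ⧸ constants τ) →ₗ[ℂ] (ℤ → ℕ+ →₀ ℂ) :=
  (constants τ).liftQ (sigma τ) (constants_le_ker τ)

/-- The space `𝒫^ℕ = ⨁_{l ≥ 1} ℂ[m] e_l` of the maps `m ↦ ∑ p_l(m) e_l`, with finitely many nonzero
polynomials `p_l`. -/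
def polyMaps : Submodule ℂ (ℤ → ℕ+ →₀ ℂ) where
  carrier := {s | ∃ p : ℕ+ →₀ Polynomial ℂ, ∀ (m : ℤ) (l : ℕ+), s m l = (p l).eval (m : ℂ)}
  zero_mem' := ⟨0, by simp⟩
  add_mem' := by
    rintro s t ⟨p, hp⟩ ⟨q, hq⟩
    exact ⟨p + q, by simp [hp, hq]⟩
  smul_mem' := by
    rintro a s ⟨p, hp⟩
    exact ⟨a • p, by simp [hp]⟩

end QuasiElliptic

end

/-!
# The structure of the ring of special quasi-elliptic functions

Everything rests on two properties of `𝒵`: it has period `1`, and `Δ 𝒵` is the nonzero constant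
`-2πi`. Both come from Eisenstein's summation of the series of `ζ` by rows of the lattice
(`tendsto_sum_piCot`): the row of index `m` contributes `π cot (π (z - m τ))`, a constant, and a
multiple of `z` which the subtraction of `e₂ z` removes. Period `1` is then visible termwise, and
the increment along `τ` telescopes to the difference of the limits of the cotangent at `± i ∞`.

The other analytic ingredient is Liouville's theorem for quasi-elliptic functions
(`exists_eq_algebraMap_of_orderAt_nonneg`): a function in some `K_k` without poles is constant.

Every principal part at the origin is that of some `a 𝒵 + g` with `g ∈ ℂ[℘, ℘']`
(`exists_orderAt_zero_sub_nonneg`). If `f` is special elliptic, then `f - a 𝒵 - g` has constant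
difference, so it is regular on the whole lattice and thus constant; as `Δ 𝒵 ≠ 0`, this forces
`a = 0`. Hence `SK_1 = ℂ[℘, ℘']`.

On polynomials in `𝒵` over `SK_1`, the operator `Δ` is `p(X) ↦ p(X + c) - p(X)` with `c = -2πi`,
which lowers degrees, is surjective, and has only constants in its kernel. Surjectivity gives
`SK = SK_1[𝒵]` by induction on `k` (`surjective_aeval_𝒵SK`), and the kernel gives the algebraic
independence of `𝒵` (`injective_aeval_𝒵SK`).

Finally `σ` turns `Δ` into the difference operator in `m` (`sigma_shift_sub`). So `σ f` has a
vanishing iterated difference and is polynomial; the kernel of `σ` consists of constants by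
Liouville's theorem; and `σ` is onto by induction on the degree, since `Δ` is surjective on `SK`
and the families that do not depend on `m` come from the functions `a 𝒵 + g`.
-/

namespace QuasiElliptic

/-! ### The Weierstrass zeta function -/

lemma norm_weierstrassZeta_summand_le (r : ℝ) (hr : 0 < r) (s : ℂ) (hs : ‖s‖ < r) (l : ℂ)
    (h : 2 * r ≤ ‖l‖) :
    ‖1 / (s - l) + 1 / l + s / l ^ 2‖ ≤ 2 * r ^ 2 * ‖l‖ ^ (-3 : ℝ) := by
  have hsl : s ≠ l := by rintro rfl; linarith
  have hl : 0 < ‖l‖ := by linarith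
  have hl0 : l ≠ 0 := norm_pos_iff.1 hl
  have hsl0 : s - l ≠ 0 := sub_ne_zero.2 hsl
  have hle : ‖l‖ / 2 ≤ ‖s - l‖ := by
    rw [norm_sub_rev]
    exact .trans (by linarith) (norm_sub_norm_le l s)
  have e : 1 / (s - l) + 1 / l + s / l ^ 2 = s ^ 2 / (l ^ 2 * (s - l)) := by
    field_simp
    ring
  calc
    _ = ‖s‖ ^ 2 / (‖l‖ ^ 2 * ‖s - l‖) := by rw [e]; simp
    _ ≤ r ^ 2 / (‖l‖ ^ 2 * (‖l‖ / 2)) := by gcongr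
    _ = 2 * r ^ 2 / ‖l‖ ^ 3 := by field
    _ = _ := by norm_cast

/-- The Weierstrass `ζ` function with the term of index `l₀` omitted; it is regular at `l₀`. -/
noncomputable def weierstrassZetaExcept (τ : ℍ) (l₀ z : ℂ) : ℂ :=
  ∑' l : (periods τ).lattice,
    if (l : ℂ) = l₀ then 0 else (1 / (z - l) + 1 / (l : ℂ) + z / (l : ℂ) ^ 2)

lemma hasSumLocallyUniformly_weierstrassZetaExcept (τ : ℍ) (l₀ : ℂ) :
    HasSumLocallyUniformly (fun (l : (periods τ).lattice) (z : ℂ) ↦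
      if (l : ℂ) = l₀ then 0 else (1 / (z - l) + 1 / (l : ℂ) + z / (l : ℂ) ^ 2))
      (weierstrassZetaExcept τ l₀) := by
  refine (periods τ).hasSumLocallyUniformly_aux (u := (2 * · ^ 2 * ‖·‖ ^ (-3 : ℝ))) _
    (fun _ _ ↦ (ZLattice.summable_norm_rpow _ _ (by simp; norm_num)).mul_left _) fun r hr ↦
    Filter.eventually_atTop.mpr ⟨2 * r, ?_⟩
  rintro _ h s hs l rfl
  split_ifs
  · simpa using! show 0 ≤ 2 * r ^ 2 * (‖(l : ℂ)‖ ^ 3)⁻¹ by positivity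
  · exact norm_weierstrassZeta_summand_le r hr s hs l h

lemma analyticAt_weierstrassZetaExcept (τ : ℍ) (l₀ x : ℂ)
    (hx : x ∉ ((periods τ).lattice \ {l₀} : Set ℂ)) :
    AnalyticAt ℂ (weierstrassZetaExcept τ l₀) x := by
  have : DifferentiableOn ℂ (weierstrassZetaExcept τ l₀) ((periods τ).lattice \ {l₀})ᶜ := by
    refine (hasSumLocallyUniformly_weierstrassZetaExcept τ
      l₀).hasSumLocallyUniformlyOn.differentiableOn
      (.of_forall fun s ↦ .fun_sum fun i hi ↦ ?_) (periods τ).isOpen_compl_lattice_sdiff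
    split_ifs with hi
    · simp
    · refine .add (.add (.div (by fun_prop) (by fun_prop) fun y hy h0 ↦ hy ?_) (by fun_prop))
        (by fun_prop)
      rw [sub_eq_zero.1 h0]
      exact ⟨i.2, hi⟩
  exact this.analyticOnNhd (periods τ).isOpen_compl_lattice_sdiff x hx

lemma weierstrassZetaExcept_add (τ : ℍ) (l₀ : (periods τ).lattice) (z : ℂ) :
    weierstrassZetaExcept τ l₀ z + (1 / (z - l₀) + 1 / (l₀ : ℂ) + z / (l₀ : ℂ) ^ 2) =
      weierstrassZeta τ z := by
  trans weierstrassZetaExcept τ l₀ z + ∑' i : (periods τ).lattice,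
    if (i : ℂ) = l₀ then (1 / (z - l₀) + 1 / (l₀ : ℂ) + z / (l₀ : ℂ) ^ 2) else 0
  · simp
  rw [weierstrassZetaExcept, ← Summable.tsum_add]
  · rw [weierstrassZeta]
    congr with w; split_ifs <;> simp only [zero_add, add_zero, *]
  · exact ((hasSumLocallyUniformly_weierstrassZetaExcept τ l₀).hasSum (x := z)).summable
  · exact summable_of_hasFiniteSupport ((Set.finite_singleton l₀).subset (by simp))

lemma weierstrassZetaExcept_of_notMem (τ : ℍ) (l₀ : ℂ) (hl : l₀ ∉ (periods τ).lattice) :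
    weierstrassZetaExcept τ l₀ = weierstrassZeta τ := by
  delta weierstrassZetaExcept weierstrassZeta
  congr! 3 with z l
  have : l.1 ≠ l₀ := by rintro rfl; simp at hl
  simp [this]

lemma hasSum_weierstrassZeta (τ : ℍ) (z : ℂ) :
    HasSum (fun l : (periods τ).lattice ↦ (1 / (z - l) + 1 / (l : ℂ) + z / (l : ℂ) ^ 2))
      (weierstrassZeta τ z) := by
  have h := (hasSumLocallyUniformly_weierstrassZetaExcept τ ((periods τ).ω₁ / 2)).hasSum (x := z)
  rw [weierstrassZetaExcept_of_notMem τ _ (periods τ).ω₁_div_two_notMem_lattice] at h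
  convert! h using 2 with l
  rw [if_neg]
  exact fun e ↦ (periods τ).ω₁_div_two_notMem_lattice (e ▸ l.2)

lemma analyticAt_weierstrassZeta (τ : ℍ) {x : ℂ} (hx : x ∉ (periods τ).lattice) :
    AnalyticAt ℂ (weierstrassZeta τ) x := by
  rw [← weierstrassZetaExcept_of_notMem τ _ hx]
  exact analyticAt_weierstrassZetaExcept τ _ _ (by simp)

lemma analyticAt_eisensteinZeta (τ : ℍ) {x : ℂ} (hx : x ∉ (periods τ).lattice) :
    AnalyticAt ℂ (eisensteinZeta τ) x := by
  have := analyticAt_weierstrassZeta τ hx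
  unfold eisensteinZeta
  fun_prop

/-- At a lattice point, `𝒵` is the sum of a simple polar term and a regular function. -/
lemma exists_analyticAt_eisensteinZeta_eq (τ : ℍ) {x : ℂ} (hx : x ∈ (periods τ).lattice) :
    ∃ h : ℂ → ℂ, AnalyticAt ℂ h x ∧ eisensteinZeta τ = fun z ↦ 1 / (z - x) + h z := by
  have := analyticAt_weierstrassZetaExcept τ x x (by simp)
  refine ⟨fun z ↦ weierstrassZetaExcept τ x z + (1 / x + z / x ^ 2) - EisensteinSeries.G2 τ * z,
    ?_, ?_⟩
  · have h2 : AnalyticAt ℂ (fun z : ℂ ↦ z / x ^ 2) x := by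
      simp only [div_eq_mul_inv]; fun_prop
    fun_prop
  · funext z
    rw [eisensteinZeta, ← weierstrassZetaExcept_add τ ⟨x, hx⟩]
    ring

lemma meromorphic_eisensteinZeta (τ : ℍ) : Meromorphic (eisensteinZeta τ) := by
  intro x
  by_cases hx : x ∈ (periods τ).lattice
  · obtain ⟨h, hh, e⟩ := exists_analyticAt_eisensteinZeta_eq τ hx
    have := hh.meromorphicAt
    rw [e]
    fun_prop
  · exact (analyticAt_eisensteinZeta τ hx).meromorphicAt

/-! ### Eisenstein summation -/

open scoped Real in
/-- The function `π cot (π w)`, the Eisenstein sum of the `1 / (w - n)` over the integers `n`. -/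
noncomputable def piCot (w : ℂ) : ℂ := π * Complex.cot (π * w)

lemma _root_.HasSum.tendsto_sum_symmetric_Icc {f : ℤ → ℂ} {a : ℂ} (h : HasSum f a) :
    Tendsto (fun N : ℕ ↦ ∑ n ∈ Finset.Icc (-(N : ℤ)) N, f n) atTop (𝓝 a) :=
  SummationFilter.hasSum_symmetricIcc_iff.1 (h.mono_left SummationFilter.LeAtTop.le_atTop)

/-- The value at `w = 0` is included: both sides are then `0`, by the convention `1 / 0 = 0`. -/
lemma tendsto_sum_one_div_sub_int (w : ℂ) (hw : w ∈ Complex.integerComplement ∨ w = 0) :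
    Tendsto (fun N : ℕ ↦ ∑ n ∈ Finset.Icc (-(N : ℤ)) N, 1 / (w - n)) atTop (𝓝 (piCot w)) := by
  have hsum : ∀ N : ℕ, ∑ n ∈ Finset.Icc (-(N : ℤ)) N, 1 / (w - n) =
      1 / w + ∑ j ∈ Finset.range N, cotTerm w j := by
    intro N
    induction N with
    | zero => simp
    | succ N ih =>
      rw [Nat.cast_succ, Finset.sum_Icc_succ_eq_add_endpoints, ih, Finset.sum_range_succ, cotTerm]
      push_cast
      ring_nf
  simp only [hsum]
  rcases hw with hw | rfl
  · simpa [piCot] using (tendsto_logDeriv_euler_cot_sub hw).const_add (1 / w)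
  · have : ∀ j, cotTerm 0 j = 0 := fun j ↦ by
      rw [cotTerm, zero_sub, zero_add, one_div, one_div, inv_neg, neg_add_cancel]
    simp [this, piCot, Complex.cot]

lemma piCot_add_one (w : ℂ) : piCot (w + 1) = piCot w := by
  rw [piCot, piCot, Complex.cot_pi_eq_exp_ratio, Complex.cot_pi_eq_exp_ratio, mul_add, mul_one,
    Complex.exp_add, Complex.exp_two_pi_mul_I, mul_one]

open scoped Real in
/-- `π cot (π w)` tends to `-π i` as `Im w → +∞`. -/
lemma tendsto_piCot_comap_im_atTop :
    Tendsto piCot (comap Complex.im atTop) (𝓝 (-(π * Complex.I))) := by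
  have hq : Tendsto (fun w : ℂ ↦ Complex.exp (2 * π * Complex.I * w))
      (comap Complex.im atTop) (𝓝 0) := by
    rw [tendsto_zero_iff_norm_tendsto_zero]
    have : (fun w : ℂ ↦ ‖Complex.exp (2 * π * Complex.I * w)‖) =
        (fun t : ℝ ↦ Real.exp (-(2 * π * t))) ∘ Complex.im := by
      funext w
      simp [Complex.norm_exp]
    rw [this]
    refine Tendsto.comp ?_ tendsto_comap
    exact Real.tendsto_exp_neg_atTop_nhds_zero.comp
      (tendsto_id.const_mul_atTop (by positivity : (0 : ℝ) < 2 * π))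
  have h : Tendsto (fun w : ℂ ↦ π * ((Complex.exp (2 * π * Complex.I * w) + 1) /
      (Complex.I * (1 - Complex.exp (2 * π * Complex.I * w))))) (comap Complex.im atTop)
      (𝓝 (π * ((0 + 1) / (Complex.I * (1 - 0))))) :=
    ((hq.add_const 1).div ((hq.const_sub 1).const_mul Complex.I) (by simp)).const_mul _
  simp only [← Complex.cot_pi_eq_exp_ratio] at h
  simpa [piCot] using! h

open scoped Real in
/-- `π cot (π w)` tends to `π i` as `Im w → -∞`. -/
lemma tendsto_piCot_comap_im_atBot :
    Tendsto piCot (comap Complex.im atBot) (𝓝 (π * Complex.I)) := by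
  have hneg : ∀ w, piCot w = -piCot (-w) := fun w ↦ by
    simp [piCot, Complex.cot, div_neg]
  have h : Tendsto (fun w : ℂ ↦ -w) (comap Complex.im atBot) (comap Complex.im atTop) := by
    rw [tendsto_comap_iff]
    exact tendsto_neg_atBot_atTop.comp tendsto_comap
  have := (tendsto_piCot_comap_im_atTop.comp h).neg
  rw [neg_neg] at this
  exact this.congr fun w ↦ (hneg w).symm

lemma mem_lattice_iff (τ : ℍ) (x : ℂ) :
    x ∈ (periods τ).lattice ↔ ∃ m n : ℤ, x = m * τ + n := by
  rw [PeriodPair.mem_lattice]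
  constructor
  · rintro ⟨n, m, rfl⟩
    exact ⟨m, n, by simp [periods, add_comm]⟩
  · rintro ⟨m, n, rfl⟩
    exact ⟨n, m, by simp [periods, add_comm]⟩

/-- The sum of the series of `ζ` over a row of the lattice. The three parts of the general term are
summed separately, as limits over symmetric intervals, the first two being only conditionally
convergent. -/
lemma eq_of_hasSum_weierstrassZeta_row (τ : ℍ) {z : ℂ} (hz : z ∉ (periods τ).lattice)
    (m : ℤ) (a : ℂ) (h : HasSum (fun n : ℤ ↦ 1 / (z - (m * τ + n)) + 1 / ((m : ℂ) * τ + n) +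
      z / ((m : ℂ) * τ + n) ^ 2) a) :
    a = piCot (z - m * τ) - piCot (-(m * τ)) + EisensteinSeries.e2Summand m τ * z := by
  have h1 : Tendsto (fun N : ℕ ↦ ∑ n ∈ Finset.Icc (-(N : ℤ)) N, 1 / (z - m * τ - n)) atTop
      (𝓝 (piCot (z - m * τ))) := by
    refine tendsto_sum_one_div_sub_int _ (.inl ?_)
    rw [Complex.mem_integerComplement_iff]
    rintro ⟨n, hn⟩
    exact hz ((mem_lattice_iff τ z).2 ⟨m, n, by rw [hn]; ring⟩)
  have h2 : Tendsto (fun N : ℕ ↦ ∑ n ∈ Finset.Icc (-(N : ℤ)) N, 1 / (-(m * τ) - n : ℂ)) atTop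
      (𝓝 (piCot (-(m * τ)))) := by
    refine tendsto_sum_one_div_sub_int _ ?_
    by_cases hm : m = 0
    · right; simp [hm]
    · left
      rw [Complex.mem_integerComplement_iff]
      rintro ⟨n, hn⟩
      have him : (m : ℝ) * τ.im = 0 := by simpa using congrArg Complex.im hn
      rcases mul_eq_zero.1 him with h0 | h0
      · exact hm (by exact_mod_cast h0)
      · exact τ.im_ne_zero h0
  have h3 :=
    ((EisensteinSeries.e2Summand_summable m τ).hasSum.mul_right z).tendsto_sum_symmetric_Icc
  refine tendsto_nhds_unique h.tendsto_sum_symmetric_Icc (((h1.sub h2).add h3).congr fun N ↦ ?_)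
  rw [← Finset.sum_sub_distrib, ← Finset.sum_add_distrib]
  refine Finset.sum_congr rfl fun n _ ↦ ?_
  have e : -((m : ℂ) * τ) - n = -(m * τ + n) := by ring
  simp only [EisensteinSeries.eisSummand, Matrix.cons_val_zero, Matrix.cons_val_one, e, div_neg,
    zpow_neg, sub_neg_eq_add, sub_sub]
  rw [div_eq_mul_inv z, mul_comm z]
  rfl

/-- Eisenstein's expansion of `𝒵`: summing the rows of the lattice first turns the absolutely
convergent series of `ζ` into a symmetric sum of cotangents, and `e₂` absorbs the linear term. -/
lemma tendsto_sum_piCot (τ : ℍ) {z : ℂ} (hz : z ∉ (periods τ).lattice) :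
    Tendsto (fun N : ℕ ↦ ∑ m ∈ Finset.Icc (-(N : ℤ)) N, (piCot (z - m * τ) - piCot (-(m * τ))))
      atTop (𝓝 (eisensteinZeta τ z)) := by
  have h := (Equiv.hasSum_iff ((Equiv.prodComm ℤ ℤ).trans
    (periods τ).latticeEquivProd.toEquiv.symm)).2 (hasSum_weierstrassZeta τ z)
  have hval : ∀ p : ℤ × ℤ, (((Equiv.prodComm ℤ ℤ).trans
      (periods τ).latticeEquivProd.toEquiv.symm p : (periods τ).lattice) : ℂ) =
      p.1 * τ + p.2 := fun p ↦ by
    have := (periods τ).latticeEquiv_symm_apply p.swap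
    simp only [periods, Prod.fst_swap, Prod.snd_swap, mul_one] at this
    rw [add_comm, ← this]
    rfl
  have h' : HasSum (fun p : ℤ × ℤ ↦ 1 / (z - (p.1 * τ + p.2)) + 1 / ((p.1 : ℂ) * τ + p.2) +
      z / ((p.1 : ℂ) * τ + p.2) ^ 2) (weierstrassZeta τ z) := by
    convert! h using 2 with p
    simp only [Function.comp_apply, hval]
  have hrow : ∀ m : ℤ, Summable fun n : ℤ ↦ 1 / (z - (m * τ + n)) + 1 / ((m : ℂ) * τ + n) +
      z / ((m : ℂ) * τ + n) ^ 2 := fun m ↦ h'.summable.prod_factor m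
  have hm := (h'.prod_fiberwise fun m ↦ (hrow m).hasSum).tendsto_sum_symmetric_Icc
  simp only [fun m ↦ eq_of_hasSum_weierstrassZeta_row τ hz m _ (hrow m).hasSum] at hm
  have h4 : Tendsto (fun N : ℕ ↦ ∑ m ∈ Finset.Icc (-(N : ℤ)) N, EisensteinSeries.e2Summand m τ)
      atTop (𝓝 (EisensteinSeries.G2 τ)) :=
    SummationFilter.hasSum_symmetricIcc_iff.1
      (EisensteinSeries.summable_e2Summand_symmetricIcc τ).hasSum
  refine (hm.sub (h4.mul_const z)).congr fun N ↦ ?_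
  rw [Finset.sum_mul, ← Finset.sum_sub_distrib]
  exact Finset.sum_congr rfl fun m _ ↦ by ring

lemma add_mem_lattice_iff (τ : ℍ) {x l : ℂ} (hl : l ∈ (periods τ).lattice) :
    x + l ∈ (periods τ).lattice ↔ x ∈ (periods τ).lattice :=
  Submodule.add_mem_iff_left _ hl

lemma one_mem_lattice (τ : ℍ) : (1 : ℂ) ∈ (periods τ).lattice := (periods τ).ω₁_mem_lattice

lemma tau_mem_lattice (τ : ℍ) : (τ : ℂ) ∈ (periods τ).lattice := (periods τ).ω₂_mem_lattice

lemma eisensteinZeta_add_one (τ : ℍ) {z : ℂ} (hz : z ∉ (periods τ).lattice) :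
    eisensteinZeta τ (z + 1) = eisensteinZeta τ z := by
  have hz' := mt (add_mem_lattice_iff τ (one_mem_lattice τ)).1 hz
  refine tendsto_nhds_unique (tendsto_sum_piCot τ hz') ((tendsto_sum_piCot τ hz).congr fun N ↦ ?_)
  refine Finset.sum_congr rfl fun m _ ↦ ?_
  rw [← piCot_add_one (z - m * τ)]
  congr 2
  ring

open scoped Real in
/-- The increment of `𝒵` along `τ`: the symmetric sum of cotangents telescopes. -/
lemma eisensteinZeta_add_tau (τ : ℍ) {z : ℂ} (hz : z ∉ (periods τ).lattice) :
    eisensteinZeta τ (z + τ) = eisensteinZeta τ z - 2 * π * Complex.I := by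
  have hz' := mt (add_mem_lattice_iff τ (tau_mem_lattice τ)).1 hz
  have h := (tendsto_sum_piCot τ hz').sub (tendsto_sum_piCot τ hz)
  have htel : ∀ N : ℕ, ∑ m ∈ Finset.Icc (-(N : ℤ)) N, (piCot (z + τ - m * τ) - piCot (-(m * τ))) -
      ∑ m ∈ Finset.Icc (-(N : ℤ)) N, (piCot (z - m * τ) - piCot (-(m * τ))) =
      piCot (z + τ + N * τ) - piCot (z - N * τ) := by
    intro N
    rw [← Finset.sum_sub_distrib]
    simp only [sub_sub_sub_cancel_right]
    induction N with
    | zero => simp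
    | succ N ih =>
      rw [Nat.cast_succ, Finset.sum_Icc_succ_eq_add_endpoints, ih]
      push_cast
      ring_nf
  simp only [htel] at h
  have hN : Tendsto (fun N : ℕ ↦ (N : ℝ) * τ.im) atTop atTop :=
    tendsto_natCast_atTop_atTop.atTop_mul_const τ.im_pos
  have h1 : Tendsto (fun N : ℕ ↦ piCot (z + τ + N * τ)) atTop (𝓝 (-(π * Complex.I))) := by
    refine tendsto_piCot_comap_im_atTop.comp (tendsto_comap_iff.2 ?_)
    refine (tendsto_atTop_add_const_left _ (z + τ).im hN).congr fun N ↦ ?_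
    simp
  have h2 : Tendsto (fun N : ℕ ↦ piCot (z - N * τ)) atTop (𝓝 (π * Complex.I)) := by
    refine tendsto_piCot_comap_im_atBot.comp (tendsto_comap_iff.2 ?_)
    refine (tendsto_atBot_add_const_left _ z.im (tendsto_neg_atTop_atBot.comp hN)).congr fun N ↦ ?_
    simp [sub_eq_add_neg]
  have := tendsto_nhds_unique h (h1.sub h2)
  linear_combination this

/-! ### Differences of polynomials -/

section Polynomial

open Polynomial

variable {A : Type*} [CommRing A]

lemma coeff_taylor_sub_self {c : A} {p : A[X]} {n : ℕ} (hp : p.natDegree ≤ n + 1) (k : ℕ)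
    (hk : n ≤ k) :
    (taylor c p - p).coeff k = if k = n then (n + 1) * c * p.coeff (n + 1) else 0 := by
  have h : taylor c p = ∑ j ∈ Finset.range (n + 2), C (p.coeff j) * (X + C c) ^ j := by
    rw [taylor_apply, comp, eval₂_eq_sum_range' _ (by omega : p.natDegree < n + 2)]
  have hz : ∑ j ∈ Finset.range n, p.coeff j * (c ^ (j - k) * (j.choose k : A)) = 0 :=
    Finset.sum_eq_zero fun j hj ↦ by
      rw [Nat.choose_eq_zero_of_lt (by have := Finset.mem_range.1 hj; omega)]
      simp
  rw [coeff_sub, h, finsetSum_coeff]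
  simp only [coeff_C_mul, coeff_X_add_C_pow]
  rw [Finset.sum_range_succ, Finset.sum_range_succ, hz, zero_add]
  split_ifs with hkn
  · subst hkn
    simp
    ring
  · rcases eq_or_ne k (n + 1) with rfl | hk1
    · simp
    · rw [coeff_eq_zero_of_natDegree_lt (by omega : p.natDegree < k),
        Nat.choose_eq_zero_of_lt (by omega), Nat.choose_eq_zero_of_lt (by omega)]
      simp

lemma degree_taylor_sub_self_lt {c : A} {p : A[X]} {n : ℕ} (hp : p.degree < (n + 1 : ℕ)) :
    (taylor c p - p).degree < n := by
  rw [degree_lt_iff_coeff_zero]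
  intro k hk
  have hn : p.natDegree ≤ n + 1 := natDegree_le_of_degree_le hp.le
  rw [coeff_taylor_sub_self hn k hk, coeff_eq_zero_of_degree_lt hp]
  simp

variable [Algebra ℂ A]

/-- The difference operator `p(X) ↦ p(X + c) - p(X)` is surjective on polynomials. -/
lemma exists_taylor_sub_self_eq {c : ℂ} (hc : c ≠ 0) (p : A[X]) :
    ∃ q : A[X], taylor (algebraMap ℂ A c) q - q = p := by
  obtain ⟨n, hn⟩ : ∃ n : ℕ, p.degree < n := ⟨p.natDegree + 1, by
    exact_mod_cast (degree_le_natDegree).trans_lt (by exact_mod_cast Nat.lt_succ_self _)⟩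
  induction n generalizing p with
  | zero => exact ⟨0, by simpa using (degree_eq_bot.1 (by simpa using hn)).symm⟩
  | succ n ih =>
    -- The difference of this monomial has the same coefficient of `X ^ n` as `p`.
    set q₀ : A[X] := C (algebraMap ℂ A ((n + 1) * c)⁻¹ * p.coeff n) * X ^ (n + 1) with hq₀
    have hq₀d : q₀.natDegree ≤ n + 1 := natDegree_C_mul_X_pow_le _ _
    obtain ⟨q, hq⟩ := ih (p - (taylor (algebraMap ℂ A c) q₀ - q₀)) (by
      rw [degree_lt_iff_coeff_zero]
      intro k hk
      rw [coeff_sub, coeff_taylor_sub_self hq₀d k hk]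
      split_ifs with hkn
      · subst hkn
        have hk0 : ((k : ℂ) + 1) * c ≠ 0 := mul_ne_zero (by exact_mod_cast k.succ_ne_zero) hc
        have h1 : ((k : A) + 1) * algebraMap ℂ A c * algebraMap ℂ A ((k + 1) * c)⁻¹ = 1 := by
          have : ((k : A) + 1) = algebraMap ℂ A (k + 1) := by simp
          rw [this, ← map_mul, ← map_mul, mul_inv_cancel₀ hk0, map_one]
        rw [hq₀, coeff_C_mul_X_pow, if_pos rfl, ← mul_assoc, h1, one_mul, sub_self]
      · rw [sub_zero]
        exact coeff_eq_zero_of_degree_lt (hn.trans_le (by exact_mod_cast (by omega : n + 1 ≤ k))))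
    exact ⟨q + q₀, by rw [map_add, add_sub_add_comm, hq, sub_add_cancel]⟩

/-- A polynomial annihilated by a point whose increments under an endomorphism are a nonzero
constant is zero: applying the endomorphism replaces `p(X)` by `p(X + c)`, so a relation of least
degree is invariant under `X ↦ X + c`, hence constant. -/
lemma eq_zero_of_aeval_eq_zero {B : Type*} [CommRing B] [Algebra A B] (hAB : Function.Injective
    (algebraMap A B)) {c : ℂ} (hc : c ≠ 0) (s : B →ₐ[A] B) {t : B}
    (ht : s t = t + algebraMap A B (algebraMap ℂ A c)) (p : A[X]) (hp : aeval t p = 0) : p = 0 := by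
  obtain ⟨n, hn⟩ : ∃ n : ℕ, p.degree < n := ⟨p.natDegree + 1, by
    exact_mod_cast (degree_le_natDegree).trans_lt (by exact_mod_cast Nat.lt_succ_self _)⟩
  induction n generalizing p with
  | zero => exact degree_eq_bot.1 (by simpa using hn)
  | succ n ih =>
    have h1 : aeval t (taylor (algebraMap ℂ A c) p) = 0 := by
      rw [taylor_apply, aeval_comp]
      simp only [map_add, aeval_X, aeval_C]
      rw [← ht, aeval_algHom_apply, hp, map_zero]
    have h2 := ih (taylor (algebraMap ℂ A c) p - p) (by rw [map_sub, h1, hp, sub_zero])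
      (degree_taylor_sub_self_lt hn)
    have hnd : p.natDegree ≤ n :=
      natDegree_le_iff_coeff_eq_zero.2 fun k hk ↦ (degree_lt_iff_coeff_zero _ _).1 hn k hk
    rcases n with _ | n
    · rw [eq_C_of_natDegree_le_zero hnd] at hp ⊢
      rw [aeval_C] at hp
      rw [hAB (hp.trans (map_zero _).symm), C_0]
    · -- The coefficient of `X ^ n` in `p(X + c) - p(X)` is `(n + 1) c` times that of `X ^ (n + 1)`
      -- in `p`, so invariance lowers the degree of `p`.
      refine ih p hp ?_
      have h3 := coeff_taylor_sub_self (c := algebraMap ℂ A c) hnd n le_rfl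
      rw [h2, coeff_zero, if_pos rfl] at h3
      have hk0 : ((n : ℂ) + 1) * c ≠ 0 := mul_ne_zero (by exact_mod_cast n.succ_ne_zero) hc
      have h4 : p.coeff (n + 1) = 0 := by
        have e : ((n : A) + 1) * algebraMap ℂ A c = algebraMap ℂ A ((n + 1) * c) := by simp
        rw [e, ← Algebra.smul_def] at h3
        have := congrArg (fun a ↦ ((n + 1) * c)⁻¹ • a) h3.symm
        simpa only [smul_smul, inv_mul_cancel₀ hk0, one_smul, smul_zero] using this
      rw [degree_lt_iff_coeff_zero] at hn ⊢
      intro k hk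
      rcases eq_or_ne k (n + 1) with rfl | hk1
      · exact h4
      · exact hn k (by omega)

end Polynomial

/-! ### Orders and translations of meromorphic functions -/

lemma coe_mem_Mer {f : ℂ → ℂ} (hf : Meromorphic f) : (f : Fun) ∈ Mer := ⟨f, hf, rfl⟩

lemma orderAt_translate (a : ℂ) (φ : Fun) (x : ℂ) :
    orderAt (translate a φ) x = orderAt φ (x + a) := by
  induction φ using Germ.inductionOn with | _ f
  rw [translate_coe, orderAt_coe, orderAt_coe]
  exact meromorphicOrderAt_comp_add_const_eq_meromorphicOrderAt

lemma translate_mem_Mer (a : ℂ) {φ : Fun} (hφ : φ ∈ Mer) : translate a φ ∈ Mer := by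
  obtain ⟨f, hf, rfl⟩ := hφ
  refine ⟨fun x ↦ f (x + a), fun x ↦ ?_, (translate_coe a f).symm⟩
  exact (hf (x + a)).comp_analyticAt (f := f) (g := fun x ↦ x + a) (by fun_prop)

lemma orderAt_mul {φ ψ : Fun} (hφ : φ ∈ Mer) (hψ : ψ ∈ Mer) (x : ℂ) :
    orderAt (φ * ψ) x = orderAt φ x + orderAt ψ x := by
  obtain ⟨f, hf, rfl⟩ := hφ
  obtain ⟨g, hg, rfl⟩ := hψ
  exact meromorphicOrderAt_mul (hf x) (hg x)

lemma orderAt_pow {φ : Fun} (hφ : φ ∈ Mer) (n : ℕ) (x : ℂ) :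
    orderAt (φ ^ n) x = n * orderAt φ x := by
  obtain ⟨f, hf, rfl⟩ := hφ
  exact meromorphicOrderAt_pow (hf x)

lemma orderAt_neg (φ : Fun) (x : ℂ) : orderAt (-φ) x = orderAt φ x := by
  induction φ using Germ.inductionOn with | _ f
  exact meromorphicOrderAt_neg.symm

lemma orderAt_add_nonneg {φ ψ : Fun} (hφ : φ ∈ Mer) (hψ : ψ ∈ Mer) {x : ℂ}
    (h : 0 ≤ orderAt φ x) (h' : 0 ≤ orderAt ψ x) : 0 ≤ orderAt (φ + ψ) x := by
  obtain ⟨f, hf, rfl⟩ := hφ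
  obtain ⟨g, hg, rfl⟩ := hψ
  exact (le_min h h').trans (meromorphicOrderAt_add (hf x) (hg x))

lemma orderAt_sub_nonneg {φ ψ : Fun} (hφ : φ ∈ Mer) (hψ : ψ ∈ Mer) {x : ℂ}
    (h : 0 ≤ orderAt φ x) (h' : 0 ≤ orderAt ψ x) : 0 ≤ orderAt (φ - ψ) x := by
  rw [sub_eq_add_neg]
  exact orderAt_add_nonneg hφ (neg_mem hψ) h (by rwa [orderAt_neg])

lemma orderAt_add_algebraMap_nonneg_iff {φ : Fun} (hφ : φ ∈ Mer) (c x : ℂ) :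
    0 ≤ orderAt (φ + algebraMap ℂ Fun c) x ↔ 0 ≤ orderAt φ x := by
  have hc := orderAt_algebraMap_nonneg c x
  have hm := Mer.algebraMap_mem c
  refine ⟨fun h ↦ ?_, fun h ↦ orderAt_add_nonneg hφ hm h hc⟩
  simpa using orderAt_sub_nonneg (add_mem hφ hm) hm h hc

/-- The leading term of `φ` can be removed by a multiple of a function of known order. -/
lemma exists_lt_orderAt_sub_smul {φ ψ : Fun} (hφ : φ ∈ Mer) (hψ : ψ ∈ Mer) {x : ℂ} {n : ℤ}
    (hn : orderAt ψ x = n) (h : (n : WithTop ℤ) ≤ orderAt φ x) :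
    ∃ a : ℂ, (n : WithTop ℤ) < orderAt (φ - a • ψ) x := by
  obtain ⟨f, hf, rfl⟩ := hφ
  obtain ⟨g, hg, rfl⟩ := hψ
  rw [orderAt_coe] at hn h
  have hfg : MeromorphicAt (f * g⁻¹) x := (hf x).mul (hg x).inv
  have ho : 0 ≤ meromorphicOrderAt (f * g⁻¹) x := by
    rw [meromorphicOrderAt_mul (hf x) (hg x).inv, meromorphicOrderAt_inv, hn]
    refine le_trans ?_ (add_le_add_left h _)
    rw [← WithTop.LinearOrderedAddCommGroup.coe_neg, ← WithTop.coe_add]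
    simp
  obtain ⟨a, ha⟩ := tendsto_nhds_of_meromorphicOrderAt_nonneg hfg ho
  refine ⟨a, ?_⟩
  change _ < meromorphicOrderAt (f - a • g) x
  have hm : MeromorphicAt (f * g⁻¹ - fun _ ↦ a) x := hfg.sub (MeromorphicAt.const a x)
  have hpos : 0 < meromorphicOrderAt (f * g⁻¹ - fun _ ↦ a) x := by
    rw [← tendsto_zero_iff_meromorphicOrderAt_pos hm]
    simpa using! ha.sub (tendsto_const_nhds (x := a))
  have hne : ∀ᶠ z in 𝓝[≠] x, g z ≠ 0 :=
    (meromorphicOrderAt_ne_top_iff_eventually_ne_zero (hg x)).1 (hn ▸ WithTop.coe_ne_top)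
  have heq : (f * g⁻¹ - fun _ ↦ a) * g =ᶠ[𝓝[≠] x] f - a • g := by
    filter_upwards [hne] with z hz
    simp only [Pi.mul_apply, Pi.sub_apply, Pi.inv_apply, Pi.smul_apply, smul_eq_mul]
    field_simp
  rw [← meromorphicOrderAt_congr heq, meromorphicOrderAt_mul hm (hg x), hn]
  cases ho' : meromorphicOrderAt (f * g⁻¹ - fun _ ↦ a) x with
  | top => simp
  | coe o =>
    rw [ho', ← WithTop.coe_zero, WithTop.coe_lt_coe] at hpos
    rw [← WithTop.coe_add, WithTop.coe_lt_coe]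
    omega

/-- A meromorphic function of nonnegative order everywhere is represented by an entire function. -/
lemma exists_differentiable_of_orderAt_nonneg {φ : Fun} (hφ : φ ∈ Mer) (h : ∀ x, 0 ≤ orderAt φ x) :
    ∃ f : ℂ → ℂ, Differentiable ℂ f ∧ (f : Fun) = φ := by
  obtain ⟨f, hf, rfl⟩ := hφ
  have hU : MeromorphicOn f Set.univ := fun x _ ↦ hf x
  refine ⟨toMeromorphicNFOn f Set.univ, fun x ↦ ?_, ?_⟩
  · refine AnalyticAt.differentiableAt ?_
    rw [← (meromorphicNFOn_toMeromorphicNFOn f Set.univ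
      (Set.mem_univ x)).meromorphicOrderAt_nonneg_iff_analyticAt,
      meromorphicOrderAt_toMeromorphicNFOn hU (Set.mem_univ x)]
    exact h x
  · exact Germ.coe_eq.2 (toMeromorphicNFOn_eqOn_codiscrete hU).symm

lemma eq_of_coe_eq_of_continuous {f g : ℂ → ℂ} (hf : Continuous f) (hg : Continuous g)
    (h : (f : Fun) = g) : f = g := by
  funext x
  have h1 := eventuallyEq_nhdsNE (Germ.coe_eq.1 h) x
  exact tendsto_nhds_unique (((hf.tendsto x).mono_left nhdsWithin_le_nhds).congr' h1)
    ((hg.tendsto x).mono_left nhdsWithin_le_nhds)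

lemma periodic_of_mem_lattice {τ : ℍ} {α : Type*} {f : ℂ → α} (h1 : Function.Periodic f 1)
    (hτ : Function.Periodic f (τ : ℂ)) {l : ℂ} (hl : l ∈ (periods τ).lattice) :
    Function.Periodic f l := by
  obtain ⟨m, n, rfl⟩ := (mem_lattice_iff τ l).1 hl
  simpa using (hτ.int_mul m).add_period (h1.int_mul n)

/-! ### Regular quasi-elliptic functions -/

lemma diff_algebraMap (τ : ℍ) (c : ℂ) : diff τ (algebraMap ℂ Fun c) = 0 := by
  rw [diff_apply, AlgHom.commutes, sub_self]

lemma diff_mem_Mer (τ : ℍ) {φ : Fun} (hφ : φ ∈ Mer) : diff τ φ ∈ Mer :=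
  sub_mem (translate_mem_Mer _ hφ) hφ

lemma translate_comm (a b : ℂ) (φ : Fun) :
    translate a (translate b φ) = translate b (translate a φ) := by
  induction φ using Germ.inductionOn with | _ f
  simp only [translate_coe]
  congr 1
  funext x
  rw [add_right_comm]

lemma diff_mem_K {τ : ℍ} {k : ℕ} {φ : Fun} (hφ : φ ∈ K τ (k + 1)) : diff τ φ ∈ K τ k := by
  rw [mem_K] at hφ ⊢
  refine ⟨diff_mem_Mer τ hφ.1, ?_, ?_⟩
  · rw [diff_apply, map_sub, translate_comm, hφ.2.1]
  · rw [← Module.End.mul_apply, ← pow_succ, hφ.2.2]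

/-- Liouville's theorem for quasi-elliptic functions. If `Δ f` is constant, then the derivative
of `f` is elliptic and entire, hence constant; so `f` is affine, and constant by its period `1`. -/
lemma exists_eq_algebraMap_of_orderAt_nonneg {τ : ℍ} {k : ℕ} {φ : Fun} (hφ : φ ∈ K τ k)
    (h : ∀ x, 0 ≤ orderAt φ x) : ∃ c : ℂ, φ = algebraMap ℂ Fun c := by
  induction k generalizing φ with
  | zero =>
    have := (mem_K.1 hφ).2.2
    exact ⟨0, by simpa using this⟩
  | succ k ih =>
    have hM := (mem_K.1 hφ).1
    obtain ⟨c, hc⟩ := ih (diff_mem_K hφ) fun x ↦ by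
      rw [diff_apply]
      refine orderAt_sub_nonneg (translate_mem_Mer _ hM) hM ?_ (h x)
      rw [orderAt_translate]
      exact h _
    obtain ⟨f, hf, rfl⟩ := exists_differentiable_of_orderAt_nonneg hM h
    have h1 : (fun x ↦ f (x + 1)) = f :=
      eq_of_coe_eq_of_continuous (hf.continuous.comp (by fun_prop)) hf.continuous
        (mem_K.1 hφ).2.1
    have hτ : (fun x ↦ f (x + τ)) = fun x ↦ f x + c := by
      refine eq_of_coe_eq_of_continuous (hf.continuous.comp (by fun_prop))
        (hf.continuous.add continuous_const) ?_
      rw [diff_apply, sub_eq_iff_eq_add', algebraMap_eq] at hc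
      exact hc
    have hd1 : Function.Periodic (deriv f) 1 := fun x ↦ by
      rw [← deriv_comp_add_const, h1]
    have hdτ : Function.Periodic (deriv f) (τ : ℂ) := fun x ↦ by
      rw [← deriv_comp_add_const, hτ, deriv_add_const]
    have hd : Differentiable ℂ (deriv f) := hf.deriv
    have hconst : ∀ x, deriv f x = deriv f 0 := fun x ↦
      hd.apply_eq_apply_of_bounded (IsZLattice.isCompact_range_of_periodic (periods τ).lattice _
        hd.continuous fun z w hw ↦ periodic_of_mem_lattice hd1 hdτ hw z).isBounded x 0
    have hlin : ∀ x, f x - deriv f 0 * x = f 0 := fun x ↦ by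
      have hD : Differentiable ℂ fun x ↦ f x - deriv f 0 * x := by fun_prop
      have := is_const_of_deriv_eq_zero hD (fun y ↦ by
        rw [deriv_fun_sub (hf y) (by fun_prop), hconst y]
        simp) x 0
      simpa using this
    have hzero : deriv f 0 = 0 := by
      have e1 := hlin 1
      have e2 : f (0 + 1) = f 0 := congrFun h1 0
      rw [zero_add] at e2
      rw [e2] at e1
      linear_combination -e1
    refine ⟨f 0, ?_⟩
    rw [algebraMap_eq]
    congr 1
    funext x
    have := hlin x
    rwa [hzero, zero_mul, sub_zero] at this

lemma PolesInLattice.orderAt_nonneg {τ : ℍ} {φ : Fun} (hp : PolesInLattice τ φ)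
    (h1 : translate 1 φ = φ) (h : ∀ m : ℤ, 0 ≤ orderAt φ (m * τ)) (x : ℂ) : 0 ≤ orderAt φ x := by
  by_cases hx : x ∈ (periods τ).lattice
  · obtain ⟨m, n, rfl⟩ := (mem_lattice_iff τ x).1 hx
    have hper : Function.Periodic (orderAt φ) 1 := fun x ↦ by rw [← orderAt_translate, h1]
    have := hper.int_mul n (m * τ)
    rw [mul_one] at this
    rw [this]
    exact h m
  · exact hp x hx

/-- If `Δ φ` is constant, then regularity at the origin propagates to every point `m τ`. -/
lemma orderAt_mul_tau_nonneg {τ : ℍ} {φ : Fun} (hφ : φ ∈ Mer) {c : ℂ}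
    (hc : diff τ φ = algebraMap ℂ Fun c) (h0 : 0 ≤ orderAt φ 0) (m : ℤ) :
    0 ≤ orderAt φ (m * τ) := by
  have hper : Function.Periodic (fun x ↦ 0 ≤ orderAt φ x) (τ : ℂ) := fun x ↦ by
    rw [diff_apply, sub_eq_iff_eq_add'] at hc
    change (0 ≤ orderAt φ (x + τ)) = (0 ≤ orderAt φ x)
    rw [← orderAt_translate, hc, orderAt_add_algebraMap_nonneg_iff hφ]
  exact (hper.int_mul_eq m).mpr h0

/-! ### The generators as elements of the ring of functions -/

lemma compl_lattice_mem_codiscrete (τ : ℍ) : ((periods τ).lattice : Set ℂ)ᶜ ∈ codiscrete ℂ := by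
  rw [mem_codiscrete]
  intro x
  rw [disjoint_principal_right, mem_nhdsWithin_iff_eventually]
  filter_upwards [(periods τ).compl_lattice_sdiff_singleton_mem_nhds x] with y hy hyx
  simpa [show y ≠ x from hyx] using hy

lemma algebraMap_injective : Function.Injective (algebraMap ℂ Fun) := fun a b h ↦ by
  rw [algebraMap_eq, algebraMap_eq] at h
  exact congrFun (eq_of_coe_eq_of_continuous continuous_const continuous_const h) 0

lemma 𝒵_mem_Mer (τ : ℍ) : 𝒵 τ ∈ Mer := coe_mem_Mer (meromorphic_eisensteinZeta τ)

lemma weierP_mem_Mer (τ : ℍ) : weierP τ ∈ Mer := coe_mem_Mer (periods τ).meromorphic_weierstrassP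

lemma weierP'_mem_Mer (τ : ℍ) : weierP' τ ∈ Mer :=
  coe_mem_Mer (periods τ).meromorphic_derivWeierstrassP

lemma translate_one_𝒵 (τ : ℍ) : translate 1 (𝒵 τ) = 𝒵 τ := by
  refine Germ.coe_eq.2 ?_
  filter_upwards [compl_lattice_mem_codiscrete τ] with z hz
  exact eisensteinZeta_add_one τ hz

open scoped Real in
lemma diff_𝒵 (τ : ℍ) : diff τ (𝒵 τ) = algebraMap ℂ Fun (-(2 * π * Complex.I)) := by
  rw [diff_apply, sub_eq_iff_eq_add, algebraMap_eq]
  refine Germ.coe_eq.2 ?_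
  filter_upwards [compl_lattice_mem_codiscrete τ] with z hz
  exact (eisensteinZeta_add_tau τ hz).trans (by ring)

open scoped Real in
lemma neg_two_pi_I_ne_zero : -(2 * π * Complex.I) ≠ 0 := neg_ne_zero.2 Complex.two_pi_I_ne_zero

lemma 𝒵_mem_SK (τ : ℍ) : 𝒵 τ ∈ SK τ := by
  refine ⟨⟨2, mem_K.2 ⟨𝒵_mem_Mer τ, translate_one_𝒵 τ, ?_⟩⟩, fun x hx ↦ ?_⟩
  · rw [pow_two, Module.End.mul_apply, diff_𝒵, diff_algebraMap]
  · exact (analyticAt_eisensteinZeta τ hx).meromorphicOrderAt_nonneg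

lemma mem_SK₁_of_periodic {τ : ℍ} {f : ℂ → ℂ} (hf : Meromorphic f)
    (hper : ∀ l : (periods τ).lattice, Function.Periodic f l)
    (han : AnalyticOnNhd ℂ f (periods τ).latticeᶜ) : (f : Fun) ∈ SK₁ τ := by
  have hK : (f : Fun) ∈ K τ 1 := by
    refine mem_K.2 ⟨coe_mem_Mer hf, ?_, ?_⟩
    · rw [translate_coe]
      exact congrArg _ (funext (hper ⟨1, one_mem_lattice τ⟩))
    · rw [pow_one, diff_apply, translate_coe, sub_eq_zero]
      exact congrArg _ (funext (hper ⟨τ, tau_mem_lattice τ⟩))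
  exact ⟨⟨⟨1, hK⟩, fun x hx ↦ (han x hx).meromorphicOrderAt_nonneg⟩, hK⟩

lemma weierP_mem_SK₁ (τ : ℍ) : weierP τ ∈ SK₁ τ :=
  mem_SK₁_of_periodic (periods τ).meromorphic_weierstrassP (periods τ).periodic_weierstrassP
    (periods τ).analyticOnNhd_weierstrassP

lemma weierP'_mem_SK₁ (τ : ℍ) : weierP' τ ∈ SK₁ τ :=
  mem_SK₁_of_periodic (periods τ).meromorphic_derivWeierstrassP
    (periods τ).periodic_derivWeierstrassP (periods τ).analyticOnNhd_derivWeierstrassP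

lemma adjoin_le_SK₁ (τ : ℍ) : Algebra.adjoin ℂ {weierP τ, weierP' τ} ≤ SK₁ τ :=
  Algebra.adjoin_le (by
    rintro _ (rfl | rfl)
    exacts [weierP_mem_SK₁ τ, weierP'_mem_SK₁ τ])

lemma orderAt_𝒵_zero (τ : ℍ) : orderAt (𝒵 τ) 0 = (-1 : ℤ) := by
  obtain ⟨h, hh, e⟩ := exists_analyticAt_eisensteinZeta_eq τ (zero_mem (periods τ).lattice)
  change meromorphicOrderAt (eisensteinZeta τ) 0 = _
  rw [meromorphicOrderAt_eq_int_iff (meromorphic_eisensteinZeta τ 0)]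
  refine ⟨fun z ↦ 1 + z * h z, by fun_prop, by simp, ?_⟩
  filter_upwards [self_mem_nhdsWithin] with z hz
  have hz : z ≠ 0 := hz
  simp only [e, sub_zero, zpow_neg, zpow_one, smul_eq_mul]
  field_simp

lemma orderAt_weierP_zero (τ : ℍ) : orderAt (weierP τ) 0 = (-2 : ℤ) :=
  (periods τ).order_weierstrassP 0 (zero_mem _)

lemma orderAt_weierP'_zero (τ : ℍ) : orderAt (weierP' τ) 0 = (-3 : ℤ) := by
  have := meromorphicOrderAt_deriv_eq_sub_one (n := -2) (by norm_num) (orderAt_weierP_zero τ)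
  rwa [(periods τ).deriv_weierstrassP] at this

/-- Every order of pole other than `0` and `1` occurs among the monomials in `℘` and `℘'`. -/
lemma exists_mem_adjoin_orderAt_zero (τ : ℍ) (n : ℕ) :
    ∃ g ∈ Algebra.adjoin ℂ {weierP τ, weierP' τ}, orderAt g 0 = (-(n + 2 : ℕ) : ℤ) := by
  have hP : weierP τ ∈ Algebra.adjoin ℂ {weierP τ, weierP' τ} := Algebra.subset_adjoin (by simp)
  have hP' : weierP' τ ∈ Algebra.adjoin ℂ {weierP τ, weierP' τ} := Algebra.subset_adjoin (by simp)
  have hord : ∀ i : ℕ, orderAt (weierP τ ^ i) 0 = ((i * (-2) : ℤ) : WithTop ℤ) := fun i ↦ by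
    rw [orderAt_pow (weierP_mem_Mer τ), orderAt_weierP_zero]
    norm_cast
  obtain ⟨i, rfl | rfl⟩ := Nat.even_or_odd' n
  · refine ⟨weierP τ ^ (i + 1), pow_mem hP _, ?_⟩
    rw [hord]
    congr 1
    push_cast
    ring
  · refine ⟨weierP τ ^ i * weierP' τ, mul_mem (pow_mem hP _) hP', ?_⟩
    rw [orderAt_mul (pow_mem (weierP_mem_Mer τ) _) (weierP'_mem_Mer τ), hord, orderAt_weierP'_zero,
      ← WithTop.coe_add]
    congr 1
    push_cast
    ring

lemma adjoin_le_Mer (τ : ℍ) : Algebra.adjoin ℂ {weierP τ, weierP' τ} ≤ Mer :=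
  fun _ h ↦ SK_le_Mer τ (adjoin_le_SK₁ τ h).1

/-- Every principal part at the origin is that of a combination of `𝒵`, which carries the simple
pole, and of monomials in `℘` and `℘'`, which carry the higher ones. -/
lemma exists_orderAt_zero_sub_nonneg (τ : ℍ) {φ : Fun} (hφ : φ ∈ Mer) :
    ∃ a : ℂ, ∃ g ∈ Algebra.adjoin ℂ {weierP τ, weierP' τ}, 0 ≤ orderAt (φ - (a • 𝒵 τ + g)) 0 := by
  obtain ⟨n, hn⟩ : ∃ n : ℕ, ((-n : ℤ) : WithTop ℤ) ≤ orderAt φ 0 := by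
    cases ho : orderAt φ 0 with
    | top => exact ⟨0, le_top⟩
    | coe o => exact ⟨o.natAbs, by rw [WithTop.coe_le_coe]; omega⟩
  have hlt : ∀ (k : ℕ) (o : WithTop ℤ), ((-(k + 1 : ℕ) : ℤ) : WithTop ℤ) < o →
      ((-k : ℤ) : WithTop ℤ) ≤ o := by
    intro k o ho
    cases o with
    | top => exact le_top
    | coe o =>
      rw [WithTop.coe_lt_coe] at ho
      rw [WithTop.coe_le_coe]
      omega
  induction n generalizing φ with
  | zero => exact ⟨0, 0, zero_mem _, by simpa using hn⟩
  | succ n ih =>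
    rcases n with _ | n
    · obtain ⟨b, hb⟩ := exists_lt_orderAt_sub_smul hφ (𝒵_mem_Mer τ) (orderAt_𝒵_zero τ) hn
      obtain ⟨a, g, hg, h⟩ := ih (sub_mem hφ (Mer.smul_mem (𝒵_mem_Mer τ) b)) (hlt 0 _ hb)
      refine ⟨a + b, g, hg, ?_⟩
      convert! h using 2
      rw [add_smul]
      ring
    · obtain ⟨ψ, hψ, hord⟩ := exists_mem_adjoin_orderAt_zero τ n
      have hψM := adjoin_le_Mer τ hψ
      obtain ⟨b, hb⟩ := exists_lt_orderAt_sub_smul hφ hψM hord hn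
      obtain ⟨a, g, hg, h⟩ := ih (sub_mem hφ (Mer.smul_mem hψM b)) (hlt _ _ hb)
      refine ⟨a, g + b • ψ, add_mem hg (Subalgebra.smul_mem _ hψ b), ?_⟩
      convert! h using 2
      ring

lemma diff_smul_𝒵_add (τ : ℍ) (a : ℂ) {g : Fun} (hg : g ∈ SK₁ τ) :
    diff τ (a • 𝒵 τ + g) = algebraMap ℂ Fun (a * -(2 * Real.pi * Complex.I)) := by
  have hg0 : diff τ g = 0 := by simpa using (mem_K.1 hg.2).2.2
  rw [map_add, map_smul, diff_𝒵, hg0, add_zero, Algebra.smul_def, ← map_mul]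

/-- A special elliptic function agrees near the origin, up to a regular function, with some
`a 𝒵 + g`, `g` a polynomial in `℘` and `℘'`. The difference is regular everywhere, so constant by
Liouville's theorem, and then `a = 0` because `Δ 𝒵 ≠ 0`. -/
theorem SK₁_eq_adjoin (τ : ℍ) : SK₁ τ = Algebra.adjoin ℂ {weierP τ, weierP' τ} := by
  refine le_antisymm (fun f hf ↦ ?_) (adjoin_le_SK₁ τ)
  have hfM := SK_le_Mer τ hf.1
  obtain ⟨a, g, hg, h0⟩ := exists_orderAt_zero_sub_nonneg τ hfM
  have hg₁ := adjoin_le_SK₁ τ hg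
  have hh : f - (a • 𝒵 τ + g) ∈ SK τ :=
    sub_mem hf.1 (add_mem ((SK τ).smul_mem (𝒵_mem_SK τ) a) hg₁.1)
  have hf0 : diff τ f = 0 := by simpa using (mem_K.1 hf.2).2.2
  have hdiff : diff τ (f - (a • 𝒵 τ + g)) =
      algebraMap ℂ Fun (-(a * -(2 * Real.pi * Complex.I))) := by
    rw [map_sub, hf0, diff_smul_𝒵_add τ a hg₁, zero_sub, map_neg]
  obtain ⟨⟨k, hk⟩, hp⟩ := hh
  obtain ⟨c, hc⟩ := exists_eq_algebraMap_of_orderAt_nonneg hk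
    (hp.orderAt_nonneg (mem_K.1 hk).2.1 (orderAt_mul_tau_nonneg (mem_K.1 hk).1 hdiff h0))
  rw [hc, diff_algebraMap] at hdiff
  have ha : a = 0 := by
    have := algebraMap_injective ((map_zero _).trans hdiff)
    have := neg_eq_zero.1 this.symm
    exact (mul_eq_zero.1 this).resolve_right neg_two_pi_I_ne_zero
  rw [ha, zero_smul, zero_add, sub_eq_iff_eq_add] at hc
  rw [hc]
  exact add_mem (Subalgebra.algebraMap_mem _ c) hg

/-! ### The ring of special quasi-elliptic functions as a polynomial ring -/

lemma translate_tau_mem_SK {τ : ℍ} {φ : Fun} (hφ : φ ∈ SK τ) : translate (τ : ℂ) φ ∈ SK τ := by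
  obtain ⟨⟨k, hk⟩, hp⟩ := hφ
  refine ⟨⟨k, ?_⟩, fun x hx ↦ ?_⟩
  · have := add_mem (diff_mem_K (K_mono τ k.le_succ hk)) hk
    rwa [diff_apply, sub_add_cancel] at this
  · rw [orderAt_translate]
    exact hp _ (mt (add_mem_lattice_iff τ (tau_mem_lattice τ)).1 hx)

lemma mem_SK₁_iff {τ : ℍ} {φ : Fun} : φ ∈ SK₁ τ ↔ φ ∈ SK τ ∧ translate (τ : ℂ) φ = φ := by
  refine ⟨fun h ↦ ⟨h.1, ?_⟩, fun ⟨h, h1⟩ ↦ ⟨h, ?_⟩⟩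
  · have := (mem_K.1 h.2).2.2
    rwa [pow_one, diff_apply, sub_eq_zero] at this
  · obtain ⟨⟨k, hk⟩, -⟩ := h
    rw [mem_K] at hk ⊢
    exact ⟨hk.1, hk.2.1, by rw [pow_one, diff_apply, h1, sub_self]⟩

/-- Translation by `τ` on `SK`, as an endomorphism over the ring of special elliptic functions. -/
noncomputable def shift (τ : ℍ) : SK τ →ₐ[SK₁ τ] SK τ where
  toFun φ := ⟨translate (τ : ℂ) φ, translate_tau_mem_SK φ.2⟩
  map_one' := Subtype.ext (map_one _)
  map_mul' φ ψ := Subtype.ext (map_mul _ (φ : Fun) ψ)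
  map_zero' := Subtype.ext (map_zero _)
  map_add' φ ψ := Subtype.ext (map_add _ (φ : Fun) ψ)
  commutes' a := Subtype.ext (mem_SK₁_iff.1 a.2).2

/-- Eisenstein's `𝒵` as an element of `SK`. -/
noncomputable def 𝒵SK (τ : ℍ) : SK τ := ⟨𝒵 τ, 𝒵_mem_SK τ⟩

open scoped Real in
lemma shift_𝒵SK (τ : ℍ) : shift τ (𝒵SK τ) =
    𝒵SK τ + algebraMap (SK₁ τ) (SK τ) (algebraMap ℂ (SK₁ τ) (-(2 * π * Complex.I))) := by
  refine Subtype.ext ?_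
  have := diff_𝒵 τ
  rw [diff_apply, sub_eq_iff_eq_add'] at this
  exact this

lemma injective_aeval_𝒵SK (τ : ℍ) :
    Function.Injective (Polynomial.aeval (R := SK₁ τ) (𝒵SK τ)) :=
  (injective_iff_map_eq_zero _).2 <| eq_zero_of_aeval_eq_zero
    (Subalgebra.inclusion_injective (SK₁_le_SK τ)) neg_two_pi_I_ne_zero (shift τ) (shift_𝒵SK τ)

open scoped Real in
lemma shift_aeval_sub (τ : ℍ) (q : Polynomial (SK₁ τ)) :
    shift τ (Polynomial.aeval (𝒵SK τ) q) - Polynomial.aeval (𝒵SK τ) q =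
      Polynomial.aeval (𝒵SK τ) (Polynomial.taylor
        (algebraMap ℂ (SK₁ τ) (-(2 * π * Complex.I))) q - q) := by
  refine Eq.trans ?_ (map_sub (Polynomial.aeval (𝒵SK τ)) _ q).symm
  rw [Polynomial.taylor_apply, Polynomial.aeval_comp, map_add, Polynomial.aeval_X,
    Polynomial.aeval_C, ← shift_𝒵SK, Polynomial.aeval_algHom_apply]

/-- By induction on `k`, for `f ∈ K_k`: the difference `Δ f` is a polynomial in `𝒵`, hence the
difference of a polynomial in `𝒵`, which differs from `f` by a special elliptic function. -/
lemma surjective_aeval_𝒵SK (τ : ℍ) :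
    Function.Surjective (Polynomial.aeval (R := SK₁ τ) (𝒵SK τ)) := by
  intro f
  obtain ⟨k, hk⟩ := f.2.1
  induction k generalizing f with
  | zero =>
    have h0 : (f : Fun) = 0 := by simpa using (mem_K.1 hk).2.2
    exact ⟨0, by rw [map_zero]; exact Subtype.ext h0.symm⟩
  | succ k ih =>
    obtain ⟨p, hp⟩ := ih (shift τ f - f) (diff_mem_K hk)
    obtain ⟨q, hq⟩ := exists_taylor_sub_self_eq neg_two_pi_I_ne_zero p
    have hs := shift_aeval_sub τ q
    rw [hq, hp] at hs
    have hinv : shift τ (f - Polynomial.aeval (𝒵SK τ) q) = f - Polynomial.aeval (𝒵SK τ) q := by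
      rw [map_sub]
      linear_combination -hs
    have hmem : ((f - Polynomial.aeval (𝒵SK τ) q : SK τ) : Fun) ∈ SK₁ τ :=
      mem_SK₁_iff.2 ⟨Subtype.property _, congrArg Subtype.val hinv⟩
    refine ⟨q + Polynomial.C ⟨_, hmem⟩, ?_⟩
    rw [map_add, Polynomial.aeval_C]
    exact add_sub_cancel _ f

/-! ### Principal parts -/

lemma HasPrincipalPart.translate {a : ℂ} {φ : Fun} {x : ℂ} {c : ℕ+ →₀ ℂ}
    (h : HasPrincipalPart φ (x + a) c) : HasPrincipalPart (translate a φ) x c := by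
  have e : QuasiElliptic.translate a (polar (x + a) c : ℂ → ℂ) = (polar x c : ℂ → ℂ) := by
    rw [translate_coe]
    congr 1
    funext z
    simp only [polar, add_sub_add_right_eq_sub]
  rw [HasPrincipalPart, ← e, ← map_sub, orderAt_translate]
  exact h

lemma hasPrincipalPart_sigma (τ : ℍ) (f : SK τ) (m : ℤ) :
    HasPrincipalPart (f : Fun) (m * τ) (sigma τ f m) :=
  hasPrincipalPart_principalPart _ _

lemma sigma_eq_of_hasPrincipalPart {τ : ℍ} {f : SK τ} {m : ℤ} {c : ℕ+ →₀ ℂ}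
    (h : HasPrincipalPart (f : Fun) (m * τ) c) : sigma τ f m = c :=
  (hasPrincipalPart_sigma τ f m).unique (SK_le_Mer τ f.2) h

lemma sigma_shift (τ : ℍ) (f : SK τ) (m : ℤ) : sigma τ (shift τ f) m = sigma τ f (m + 1) := by
  refine sigma_eq_of_hasPrincipalPart (HasPrincipalPart.translate ?_)
  have := hasPrincipalPart_sigma τ f (m + 1)
  rwa [Int.cast_add, Int.cast_one, add_mul, one_mul] at this

lemma sigma_shift_sub (τ : ℍ) (f : SK τ) (m : ℤ) :
    sigma τ (shift τ f - f) m = sigma τ f (m + 1) - sigma τ f m := by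
  rw [map_sub, Pi.sub_apply, sigma_shift]

lemma eq_apply_zero_of_apply_add_one {α : Type*} {s : ℤ → α} (h : ∀ m, s (m + 1) = s m) (m : ℤ) :
    s m = s 0 := by
  simpa using Function.Periodic.int_mul_eq (f := s) (c := 1) h m

/-- A vector-valued map on `ℤ` whose differences are polynomial is polynomial. -/
lemma mem_polyMaps_of_diff_mem {s : ℤ → ℕ+ →₀ ℂ} (h : (fun m ↦ s (m + 1) - s m) ∈ polyMaps) :
    s ∈ polyMaps := by
  obtain ⟨p, hp⟩ := h
  choose r hr using fun l ↦ exists_taylor_sub_self_eq (one_ne_zero (α := ℂ)) (p l)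
  -- A solution of the difference equation is taken to be `0` where `p` is, for finite support.
  set q : ℕ+ →₀ Polynomial ℂ := Finsupp.onFinset p.support
    (fun l ↦ if p l = 0 then 0 else r l) (by simp +contextual) with hq
  have hqr : ∀ l, Polynomial.taylor (1 : ℂ) (q l) - q l = p l := fun l ↦ by
    by_cases hl : p l = 0
    · simp [hq, hl]
    · simpa [hq, hl] using hr l
  have hconst : ∀ l m, s m l - (q l).eval (m : ℂ) = s 0 l - (q l).eval ((0 : ℤ) : ℂ) := fun l ↦
    eq_apply_zero_of_apply_add_one (s := fun m : ℤ ↦ s m l - (q l).eval (m : ℂ)) fun m ↦ by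
      have h1 := hp m l
      rw [← hqr l, Polynomial.eval_sub, Polynomial.taylor_eval, Finsupp.sub_apply] at h1
      push_cast
      linear_combination h1
  have hv : ∃ v : ℕ+ →₀ ℂ, ∀ l, v l = s 0 l - (q l).eval ((0 : ℤ) : ℂ) :=
    ⟨s 0 - Finsupp.mapRange (fun P : Polynomial ℂ ↦ P.eval ((0 : ℤ) : ℂ)) (by simp) q, by simp⟩
  obtain ⟨v, hv⟩ := hv
  refine ⟨q + Finsupp.mapRange Polynomial.C (by simp) v, fun m l ↦ ?_⟩
  simp only [Finsupp.add_apply, Finsupp.mapRange_apply, Polynomial.eval_add, Polynomial.eval_C, hv]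
  linear_combination hconst l m

/-- By induction on `k`, for `f ∈ K_k`: the differences of `σ f` are the values of `σ (Δ f)`. -/
lemma sigma_mem_polyMaps (τ : ℍ) (f : SK τ) : sigma τ f ∈ polyMaps := by
  obtain ⟨k, hk⟩ := f.2.1
  induction k generalizing f with
  | zero =>
    have h0 : f = 0 := Subtype.ext (by simpa using (mem_K.1 hk).2.2)
    rw [h0, map_zero]
    exact zero_mem _
  | succ k ih =>
    refine mem_polyMaps_of_diff_mem ?_
    simpa only [← sigma_shift_sub] using ih (shift τ f - f) (diff_mem_K hk)

lemma ker_sigma_le_constants (τ : ℍ) : LinearMap.ker (sigma τ) ≤ constants τ := by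
  intro f hf
  rw [LinearMap.mem_ker] at hf
  obtain ⟨⟨k, hk⟩, hp⟩ := f.2
  obtain ⟨c, hc⟩ := exists_eq_algebraMap_of_orderAt_nonneg hk
    (hp.orderAt_nonneg (mem_K.1 hk).2.1 fun m ↦ by
      have := hasPrincipalPart_sigma τ f m
      rwa [hf, Pi.zero_apply, HasPrincipalPart, polar_zero, Germ.coe_zero, sub_zero] at this)
  exact ⟨c, Subtype.ext hc.symm⟩

lemma sigma_eq_zero_of_mem_constants {τ : ℍ} {f : SK τ} (hf : f ∈ constants τ) : sigma τ f = 0 :=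
  constants_le_ker τ hf

/-- The families of principal parts that do not depend on `m` are those of the functions
`a 𝒵 + g`, with `g` a polynomial in `℘` and `℘'`. -/
lemma exists_sigma_eq_const (τ : ℍ) (v : ℕ+ →₀ ℂ) : ∃ f : SK τ, ∀ m, sigma τ f m = v := by
  have hM := coe_mem_Mer (meromorphic_polar 0 v)
  obtain ⟨a, g, hg, h⟩ := exists_orderAt_zero_sub_nonneg τ hM
  have hg₁ := adjoin_le_SK₁ τ hg
  set f : SK τ := ⟨a • 𝒵 τ + g, add_mem ((SK τ).smul_mem (𝒵_mem_SK τ) a) hg₁.1⟩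
  refine ⟨f, fun m ↦ ?_⟩
  rw [eq_apply_zero_of_apply_add_one (s := sigma τ f) fun m ↦ ?_]
  · refine sigma_eq_of_hasPrincipalPart ?_
    rw [HasPrincipalPart, Int.cast_zero, zero_mul, ← orderAt_neg, neg_sub]
    exact h
  · rw [← sub_eq_zero, ← sigma_shift_sub, sigma_eq_zero_of_mem_constants, Pi.zero_apply]
    exact ⟨_, Subtype.ext (diff_smul_𝒵_add τ a hg₁).symm⟩

lemma surjective_shift_sub (τ : ℍ) (g : SK τ) : ∃ f : SK τ, shift τ f - f = g := by
  obtain ⟨p, rfl⟩ := surjective_aeval_𝒵SK τ g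
  obtain ⟨q, hq⟩ := exists_taylor_sub_self_eq neg_two_pi_I_ne_zero p
  exact ⟨Polynomial.aeval (𝒵SK τ) q, by rw [shift_aeval_sub, hq]⟩

/-- By induction on the degree: the difference of `s` is `σ g` for some `g`, and `g = Δ f` for
some `f`, so `s - σ f` does not depend on `m`. -/
lemma exists_sigma_eq_of_mem_polyMaps (τ : ℍ) {s : ℤ → ℕ+ →₀ ℂ} (hs : s ∈ polyMaps) :
    ∃ f : SK τ, sigma τ f = s := by
  obtain ⟨p, hp⟩ := hs
  obtain ⟨n, hn⟩ : ∃ n : ℕ, ∀ l, (p l).degree < n := by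
    refine ⟨p.support.sup (fun l ↦ (p l).natDegree) + 1, fun l ↦ ?_⟩
    by_cases hl : p l = 0
    · rw [hl, Polynomial.degree_zero]
      exact WithBot.bot_lt_coe _
    · refine (Polynomial.degree_le_natDegree).trans_lt ?_
      have := Finset.le_sup (f := fun l ↦ (p l).natDegree) (Finsupp.mem_support_iff.2 hl)
      exact_mod_cast Nat.lt_succ_of_le this
  induction n generalizing s p with
  | zero =>
    refine ⟨0, ?_⟩
    ext m l
    have hl : p l = 0 := Polynomial.degree_eq_bot.1 (by simpa using hn l)
    simp [hp, hl]
  | succ n ih =>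
    obtain ⟨g, hg⟩ := ih (s := fun m ↦ s (m + 1) - s m)
      (Finsupp.mapRange (fun P : Polynomial ℂ ↦ Polynomial.taylor 1 P - P) (by simp) p)
      (fun m l ↦ by simp [hp, Polynomial.taylor_eval])
      (fun l ↦ degree_taylor_sub_self_lt (hn l))
    obtain ⟨f, rfl⟩ := surjective_shift_sub τ g
    obtain ⟨f₀, hf₀⟩ := exists_sigma_eq_const τ (s 0 - sigma τ f 0)
    refine ⟨f + f₀, funext fun m ↦ ?_⟩
    have hconst := eq_apply_zero_of_apply_add_one (s := fun m ↦ s m - sigma τ f m) (fun m ↦ by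
      have h1 := congrFun hg m
      rw [sigma_shift_sub] at h1
      simpa only [sub_eq_sub_iff_sub_eq_sub] using h1.symm) m
    rw [map_add, Pi.add_apply, hf₀, ← hconst, add_sub_cancel]

end QuasiElliptic

theorem mainTheorem1 (τ : UpperHalfPlane) :
    -- the special elliptic functions are the polynomials in `℘` and `℘'`
    QuasiElliptic.SK₁ τ = Algebra.adjoin ℂ {QuasiElliptic.weierP τ, QuasiElliptic.weierP' τ} ∧
    -- (a)
    (∃ hZ : QuasiElliptic.𝒵 τ ∈ QuasiElliptic.SK τ,
      Function.Bijective (Polynomial.aeval (R := QuasiElliptic.SK₁ τ)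
        (⟨QuasiElliptic.𝒵 τ, hZ⟩ : QuasiElliptic.SK τ)) ∧
      ∃ b : Module.Basis ℕ (QuasiElliptic.SK₁ τ) (QuasiElliptic.SK τ),
        ∀ k : ℕ, b k = (⟨QuasiElliptic.𝒵 τ, hZ⟩ : QuasiElliptic.SK τ) ^ k) ∧
    -- (b)
    LinearMap.range (QuasiElliptic.sigma τ) ≤ QuasiElliptic.polyMaps ∧
    -- (c)
    ∃ e : (QuasiElliptic.SK τ ⧸ QuasiElliptic.constants τ) ≃ₗ[ℂ] QuasiElliptic.polyMaps,
      ∀ f : QuasiElliptic.SK τ ⧸ QuasiElliptic.constants τ,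
        (e f : ℤ → ℕ+ →₀ ℂ) = QuasiElliptic.sigmaBar τ f := by
  have hinj := QuasiElliptic.injective_aeval_𝒵SK τ
  have hsurj := QuasiElliptic.surjective_aeval_𝒵SK τ
  refine ⟨QuasiElliptic.SK₁_eq_adjoin τ, ⟨QuasiElliptic.𝒵_mem_SK τ, ⟨hinj, hsurj⟩, ?_⟩, ?_, ?_⟩
  · refine ⟨(Polynomial.basisMonomials (QuasiElliptic.SK₁ τ)).map
      (LinearEquiv.ofBijective (Polynomial.aeval (QuasiElliptic.𝒵SK τ)).toLinearMap
        ⟨hinj, hsurj⟩), fun k ↦ ?_⟩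
    rw [Module.Basis.map_apply, Polynomial.coe_basisMonomials]
    exact (Polynomial.aeval_monomial _).trans (by rw [map_one, one_mul]; rfl)
  · rintro _ ⟨f, rfl⟩
    exact QuasiElliptic.sigma_mem_polyMaps τ f
  · have hmem : ∀ f, QuasiElliptic.sigmaBar τ f ∈ QuasiElliptic.polyMaps := fun f ↦ by
      induction f using Submodule.Quotient.induction_on with | _ f
      exact QuasiElliptic.sigma_mem_polyMaps τ f
    refine ⟨LinearEquiv.ofBijective ((QuasiElliptic.sigmaBar τ).codRestrict _ hmem) ⟨?_, ?_⟩,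
      fun f ↦ rfl⟩
    · have hker := Submodule.ker_liftQ_eq_bot _ _ (QuasiElliptic.constants_le_ker τ)
        (QuasiElliptic.ker_sigma_le_constants τ)
      exact fun x y hxy ↦ LinearMap.ker_eq_bot.1 hker (congrArg Subtype.val hxy)
    · rintro ⟨s, hs⟩
      obtain ⟨f, hf⟩ := QuasiElliptic.exists_sigma_eq_of_mem_polyMaps τ hs
      exact ⟨Submodule.Quotient.mk f, Subtype.ext hf⟩
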